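/- Let $n\ge 2$ and let $\overline{\mathbb R^n}=\mathbb R^n\cup\{\infty\}$ carry the chordal metric $h(x,y)=\frac{|x-y|}{\sqrt{1+|x|^2}\sqrt{1+|y|^2}}$, $h(x,\infty)=\frac1{\sqrt{1+|x|^2}}$. For $A,B\subset\overline{\mathbb R^n}$ put $h(A,B)=\inf_{x\in A,\,y\in B}h(x,y)$ and $h(A)=\sup_{x,y\in A}h(x,y)$. The boundary $\partial D$ of a domain (nonempty connected open set) $D\subset\mathbb R^n$ is taken in $\overline{\mathbb R^n}$; closures $\overline{D_0}$ are taken in $\mathbb R^n$. A continuum is a nonempty compact connected set. Put $S(y_0,r)=\{y:|y-y_0|=r\}$ and $A(y_0,r_1,r_2)=\{y:r_1<|y-y_0|<r_2\}$. For a family $\Gamma$ of paths in $\mathbb R^n$ let $M(\Gamma)=\inf_\rho\int_{\mathbb R^n}\rho^n\,dm$, the infimum being over all Borel $\rho:\mathbb R^n\to[0,\infty]$ with $\int_\gamma\rho\,|dx|\ge1$ for every locally rectifiable $\gamma\in\Gamma$. Let $D,D_0\subset\mathbb R^n$ be domains, let $E\subset D_0$ be compact, and let $Q:\mathbb R^n\to[0,\infty]$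 be Lebesgue measurable with $Q\equiv0$ outside $D_0$. For $f:D\to\mathbb R^n$ let $\Gamma_f(y_0,r_1,r_2)$ be the family of all paths $\gamma:[a,b]\to D$ such that $f(\gamma(a))\in S(y_0,r_1)$, $f(\gamma(b))\in S(y_0,r_2)$ and $f(\gamma(t))\in A(y_0,r_1,r_2)$ for $a<t<b$. The map $f$ satisfies the inverse Poletsky inequality at $y_0$ if $$M(\Gamma_f(y_0,r_1,r_2))\le\int_{A(y_0,r_1,r_2)\cap f(D)}Q(y)\,\eta^n(|y-y_0|)\,dm(y)$$ for all $0<r_1<r_2<\sup_{y\in f(D)}|y-y_0|$ and every Lebesgue measurable $\eta:(r_1,r_2)\to[0,\infty]$ with $\int_{r_1}^{r_2}\eta(r)\,dr\ge1$. Consider continuous, open, discrete mappings $f:D\to D_0$ that are closed as mappings onto their image, a domain $f(D)$ with $E\subset f(D)\subset D_0$, that satisfy the inverse Poletsky inequality at every $y_0\in\overline{D_0}$, and for which $f^{-1}(E)$ is a continuum. For $\delta>0$, such an $f$ belongs to $\mathfrak R^E_{Q,\delta}(D,D_0)$ if $h(f^{-1}(E))\ge\delta$, and to $\mathfrak F^E_{Q,\delta}(D,D_0)$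 if $h(f^{-1}(E),\partial D)\ge\delta$. A sequence of domains $D_m$, all containing one ball centred at a point $A_0$, converges to the kernel $D_0$ if for every subsequence $(D_{m_k})$ the domain $D_0$ is the largest among the domains $G\ni A_0$ such that every compact subset of $G$ lies in $D_{m_k}$ for all sufficiently large $k$. **Lemma.** Let $\delta>0$ and let $D,D_0,E,Q$ be as above. Assume that for every $y_0\in\overline{D_0}$ and all $0<r_1<r_2<\sup_{y\in D_0}|y-y_0|$ there is a set $E_1\subset[r_1,r_2]$ of positive Lebesgue measure such that $Q$ is integrable over $S(y_0,r)$ with respect to the Hausdorff measure $\mathcal H^{n-1}$ for every $r\in E_1$. Assume that no connected component of $\partial D$ is a single point. Let $f_m\in\mathfrak R^E_{Q,\delta}(D,D_0)$, $m=1,2,\dots$, be such that the domains $f_m(D)$ converge to the kernel $D_0$ (with respect to some point $A_0$). Then there is $\delta_*>0$ such that $h(f_m^{-1}(E),\partial D)\ge\delta_*$ for every $m$, i.e. $f_m\in\mathfrak F^E_{Q,\delta_*}(D,D_0)$ for every $m$. -/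

import Mathlib

open MeasureTheory Set Filter
open scoped ENNReal Topology

noncomputable section

namespace Approaching

/-- Euclidean `n`-space. -/
abbrev Eu (n : ℕ) : Type := EuclideanSpace ℝ (Fin n)

/-- The extended space `ℝⁿ ∪ {∞}`. -/
abbrev ExtEu (n : ℕ) : Type := OnePoint (Eu n)

/-- A domain: a nonempty connected open set. -/
def IsRegion {n : ℕ} (D : Set (Eu n)) : Prop := IsOpen D ∧ IsConnected D

/-! ### The chordal metric -/

/-- The chordal (spherical) metric on `ℝⁿ ∪ {∞}`. -/
def chordal {n : ℕ} : ExtEu n → ExtEu n → ℝ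
  | none, none => 0
  | some x, none => 1 / √(1 + ‖x‖ ^ 2)
  | none, some y => 1 / √(1 + ‖y‖ ^ 2)
  | some x, some y => ‖x - y‖ / (√(1 + ‖x‖ ^ 2) * √(1 + ‖y‖ ^ 2))

/-- The chordal distance `h(A, B) = inf h(x, y)` over `x ∈ A`, `y ∈ B`. -/
def chordalDist {n : ℕ} (A B : Set (ExtEu n)) : ℝ≥0∞ :=
  ⨅ x ∈ A, ⨅ y ∈ B, ENNReal.ofReal (chordal x y)

/-- The chordal diameter `h(A) = sup h(x, y)` over `x, y ∈ A`. -/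
def chordalDiam {n : ℕ} (A : Set (ExtEu n)) : ℝ≥0∞ :=
  ⨆ x ∈ A, ⨆ y ∈ A, ENNReal.ofReal (chordal x y)

/-- A subset of `ℝⁿ`, seen in the extended space. -/
def toExt {n : ℕ} (A : Set (Eu n)) : Set (ExtEu n) := (fun x : Eu n => (x : ExtEu n)) '' A

/-- The boundary of `D ⊆ ℝⁿ`, taken in the extended space. -/
def extBoundary {n : ℕ} (D : Set (Eu n)) : Set (ExtEu n) := frontier (toExt D)

/-- No connected component of the boundary is a single point. -/
def NondegenerateBoundary {n : ℕ} (D : Set (Eu n)) : Prop :=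
  ∀ x ∈ extBoundary D, (connectedComponentIn (extBoundary D) x).Nontrivial

/-! ### Paths and the conformal modulus -/

/-- A path `γ : [a, b] → ℝⁿ` (the values off `[a, b]` are irrelevant). -/
structure ClosedPath (n : ℕ) where
  a : ℝ
  b : ℝ
  le : a ≤ b
  toFun : ℝ → Eu n
  cont : ContinuousOn toFun (Icc a b)

/-- The length of a path. -/
def ClosedPath.length {n : ℕ} (γ : ClosedPath n) : ℝ≥0∞ :=
  eVariationOn γ.toFun (Icc γ.a γ.b)

/-- `∫_γ ρ |dx|` for a rectifiable path `γ`: the integral of `ρ` along the arc length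
parametrization of `γ` over `[0, length γ]`. -/
def ClosedPath.lineIntegral {n : ℕ} (γ : ClosedPath n) (ρ : Eu n → ℝ≥0∞) : ℝ≥0∞ :=
  ∫⁻ s in Icc 0 γ.length.toReal, ρ (naturalParameterization γ.toFun (Icc γ.a γ.b) γ.a s)

/-- `ρ ∈ adm Γ`. A path on a compact interval is locally rectifiable if and only if its length
is finite. -/
def Admissible {n : ℕ} (Γ : Set (ClosedPath n)) (ρ : Eu n → ℝ≥0∞) : Prop :=
  Measurable ρ ∧ ∀ γ ∈ Γ, γ.length ≠ ∞ → 1 ≤ γ.lineIntegral ρ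

/-- The modulus `M(Γ) = M_n(Γ)` of a family of paths. -/
def modulus {n : ℕ} (Γ : Set (ClosedPath n)) : ℝ≥0∞ :=
  ⨅ (ρ : Eu n → ℝ≥0∞) (_ : Admissible Γ ρ), ∫⁻ x, ρ x ^ n

/-- The spherical ring `A(y₀, r₁, r₂)`. -/
def ring {n : ℕ} (y₀ : Eu n) (r₁ r₂ : ℝ) : Set (Eu n) := {y | r₁ < dist y y₀ ∧ dist y y₀ < r₂}

/-- `β : [a, b] → ℝⁿ` starts in `S`, ends in `T` and runs in `G` in between. -/
def Joins {n : ℕ} (a b : ℝ) (β : ℝ → Eu n) (S T G : Set (Eu n)) : Prop :=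
  β a ∈ S ∧ β b ∈ T ∧ ∀ t ∈ Ioo a b, β t ∈ G

/-- `Γ_f(y₀, r₁, r₂)`: the paths in `D` whose image under `f` joins the spheres
`S(y₀, r₁)` and `S(y₀, r₂)` in the ring between them. -/
def ringFamily {n : ℕ} (D : Set (Eu n)) (f : Eu n → Eu n) (y₀ : Eu n) (r₁ r₂ : ℝ) :
    Set (ClosedPath n) :=
  {γ | (∀ t ∈ Icc γ.a γ.b, γ.toFun t ∈ D) ∧
    Joins γ.a γ.b (fun t => f (γ.toFun t)) (Metric.sphere y₀ r₁) (Metric.sphere y₀ r₂)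
      (ring y₀ r₁ r₂)}

/-- `sup |y - y₀|` over `y ∈ G`, possibly infinite. -/
def outerRadius {n : ℕ} (G : Set (Eu n)) (y₀ : Eu n) : ℝ≥0∞ := ⨆ y ∈ G, edist y y₀

/-- The inverse Poletsky inequality for `f` on `D` at the point `y₀`. For functions with values
in `[0, ∞]`, Lebesgue measurability is the same as `AEMeasurable`. -/
def InversePoletsky {n : ℕ} (D : Set (Eu n)) (f : Eu n → Eu n) (Q : Eu n → ℝ≥0∞)
    (y₀ : Eu n) : Prop :=
  ∀ r₁ r₂ : ℝ, 0 < r₁ → r₁ < r₂ → ENNReal.ofReal r₂ < outerRadius (f '' D) y₀ →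
    ∀ η : ℝ → ℝ≥0∞, AEMeasurable η (volume.restrict (Ioo r₁ r₂)) →
      1 ≤ ∫⁻ r in Ioo r₁ r₂, η r →
      modulus (ringFamily D f y₀ r₁ r₂) ≤
        ∫⁻ y in ring y₀ r₁ r₂ ∩ f '' D, Q y * η (dist y y₀) ^ n

/-! ### The classes of mappings

A mapping `D → ℝⁿ` is given by a function on `ℝⁿ` of which only the values on `D` matter. -/

/-- `f` is a continuous, open, discrete and closed mapping of `D` (closed: onto its image). -/
structure OpenDiscreteClosed {n : ℕ} (D : Set (Eu n)) (f : Eu n → Eu n) : Prop where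
  continuousOn : ContinuousOn f D
  isOpen_image : ∀ U ⊆ D, IsOpen U → IsOpen (f '' U)
  isDiscrete_fiber : ∀ y, IsDiscrete (D ∩ f ⁻¹' {y})
  isClosed_image : ∀ A, IsClosed A → ∃ C, IsClosed C ∧ f '' (D ∩ A) = f '' D ∩ C

/-- The requirements common to both classes below. -/
structure BaseClass {n : ℕ} (E : Set (Eu n)) (Q : Eu n → ℝ≥0∞) (D D₀ : Set (Eu n))
    (f : Eu n → Eu n) : Prop where
  openDiscreteClosed : OpenDiscreteClosed D f
  isRegion_image : IsRegion (f '' D)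
  subset_image : E ⊆ f '' D
  image_subset : f '' D ⊆ D₀
  inversePoletsky : ∀ y₀ ∈ closure D₀, InversePoletsky D f Q y₀

/-- A continuum: a nonempty compact connected set. -/
def IsContinuum {n : ℕ} (K : Set (Eu n)) : Prop := IsCompact K ∧ IsConnected K

/-- The class `𝔉`: `f⁻¹(E)` is a continuum at chordal distance at least `δ` from `∂D`. -/
def classF {n : ℕ} (E : Set (Eu n)) (Q : Eu n → ℝ≥0∞) (δ : ℝ) (D D₀ : Set (Eu n)) :
    Set (Eu n → Eu n) :=
  {f | BaseClass E Q D D₀ f ∧ IsContinuum (D ∩ f ⁻¹' E) ∧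
    ENNReal.ofReal δ ≤ chordalDist (toExt (D ∩ f ⁻¹' E)) (extBoundary D)}

/-- The class `ℜ`: `f⁻¹(E)` is a continuum of chordal diameter at least `δ`. -/
def classR {n : ℕ} (E : Set (Eu n)) (Q : Eu n → ℝ≥0∞) (δ : ℝ) (D D₀ : Set (Eu n)) :
    Set (Eu n → Eu n) :=
  {f | BaseClass E Q D D₀ f ∧ IsContinuum (D ∩ f ⁻¹' E) ∧
    ENNReal.ofReal δ ≤ chordalDiam (toExt (D ∩ f ⁻¹' E))}

/-! ### Kernel convergence -/

/-- `G` is a domain containing `A₀`, each compact subset of which lies in all but finitely many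
of the `Dm`. -/
def EventuallyCovered {n : ℕ} (A₀ : Eu n) (Dm : ℕ → Set (Eu n)) (G : Set (Eu n)) : Prop :=
  IsRegion G ∧ A₀ ∈ G ∧ ∀ K ⊆ G, IsCompact K → ∃ N, ∀ m ≥ N, K ⊆ Dm m

/-- `D₀` is the kernel of `Dm` with respect to `A₀`: the largest such domain. -/
def IsKernel {n : ℕ} (A₀ : Eu n) (Dm : ℕ → Set (Eu n)) (D₀ : Set (Eu n)) : Prop :=
  EventuallyCovered A₀ Dm D₀ ∧ ∀ G, EventuallyCovered A₀ Dm G → G ⊆ D₀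

/-- The domains `Dm` have a common ball around some point `A₀`, and every subsequence has `D₀`
as its kernel with respect to `A₀`. -/
def ConvergesToKernel {n : ℕ} (Dm : ℕ → Set (Eu n)) (D₀ : Set (Eu n)) : Prop :=
  ∃ A₀ : Eu n, (∃ r > 0, ∀ m, Metric.ball A₀ r ⊆ Dm m) ∧
    ∀ φ : ℕ → ℕ, StrictMono φ → IsKernel A₀ (fun k => Dm (φ k)) D₀

/-! ### Integrability over spheres -/

/-- For all `y₀` in the closure of `D₀` and `0 < r₁ < r₂ < sup |y - y₀|` over `y ∈ D₀`, the
function `Q` is integrable over `S(y₀, r)` with respect to the `(n-1)`-dimensional Hausdorff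
measure, for all `r` in a subset of `[r₁, r₂]` of positive measure. -/
def IntegrableOverSpheres {n : ℕ} (D₀ : Set (Eu n)) (Q : Eu n → ℝ≥0∞) : Prop :=
  ∀ y₀ ∈ closure D₀, ∀ r₁ r₂ : ℝ, 0 < r₁ → r₁ < r₂ → ENNReal.ofReal r₂ < outerRadius D₀ y₀ →
    ∃ E₁ ⊆ Icc r₁ r₂, NullMeasurableSet E₁ (volume : Measure ℝ) ∧ 0 < volume E₁ ∧
      ∀ r ∈ E₁,
        AEMeasurable Q ((Measure.hausdorffMeasure ((n : ℝ) - 1)).restrict (Metric.sphere y₀ r)) ∧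
        ∫⁻ y in Metric.sphere y₀ r, Q y ∂(Measure.hausdorffMeasure ((n : ℝ) - 1)) < ∞

end Approaching

end

/-!
The integrability of `Q` over spheres yields, for each small ring in `D₀`, a weight `η` supported on
radii where the spherical means of `Q` are bounded. Since `f` is closed, the image under `f` of a
path leaving `D` leaves every compact subset of `f(D)`. Hence, covering `E` by finitely many balls,
the inverse Poletsky inequality provides for all but finitely many `m` a density `ρ` that is
admissible for the paths from `f_m⁻¹(E)` out of `D`, with `∫ ρⁿ` bounded independently of `m`.

If `f_m⁻¹(E)`, which has chordal diameter at least `δ`, came close to a boundary point `p`, then it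
and the nondegenerate boundary component of `p` would both meet every sphere of a ring of large
ratio, centred at `p`, or at `0` if `p = ∞`. The `n`-th power of an admissible density has an
integral at least a constant times `1/r` over the sphere of radius `r`, so `∫ ρⁿ` would be at least
a constant times the logarithm of the ratio.

Hence no boundary point lies in the closure of the union of the sets `f_m⁻¹(E)`, and two disjoint
compact sets have positive chordal distance.
-/

noncomputable section

namespace Approaching

open Metric Module NormedSpace

open scoped NNReal RealInnerProductSpace

section PolarCoordinates

variable {V : Type*} [NormedAddCommGroup V] [NormedSpace ℝ V]

theorem smul_mem_closedBall_two_mul {x θ : sphere (0 : V) 1} {d r : ℝ} (hr : r ∈ Icc 1 (1 + d))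
    (hθ : θ ∈ closedBall x d) : r • (θ : V) ∈ closedBall (x : V) (2 * d) := by
  have hθ1 : ‖(θ : V)‖ = 1 := by simp
  have hθx : ‖(θ : V) - x‖ ≤ d := by rwa [← dist_eq_norm]
  rw [mem_closedBall, dist_eq_norm]
  calc ‖r • (θ : V) - x‖ = ‖(r - 1) • (θ : V) + (θ - x)‖ := by congr 1; module
    _ ≤ (r - 1) * 1 + ‖(θ : V) - x‖ := by
        grw [norm_add_le, norm_smul, Real.norm_of_nonneg (sub_nonneg.2 hr.1), hθ1]
    _ ≤ 2 * d := by linarith [hr.2]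

variable [FiniteDimensional ℝ V] [MeasurableSpace V] [BorelSpace V] {μ : Measure V}
  [μ.IsAddHaarMeasure]

theorem measurable_lintegral_sphere {g : V → ℝ≥0∞} (hg : Measurable g) (y₀ : V) :
    Measurable fun r : ℝ => ∫⁻ θ, g (y₀ + r • (θ : V)) ∂μ.toSphere :=
  Measurable.lintegral_prod_right' (f := fun p : ℝ × sphere (0 : V) 1 => g (y₀ + p.1 • (p.2 : V)))
    (by fun_prop)

theorem lintegral_polar [Nontrivial V] {g : V → ℝ≥0∞} (hg : Measurable g) (y₀ : V) :
    ∫⁻ y, g y ∂μ = ∫⁻ r in Ioi (0 : ℝ), ENNReal.ofReal (r ^ (finrank ℝ V - 1)) *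
      ∫⁻ θ, g (y₀ + r • (θ : V)) ∂μ.toSphere := by
  have hsymm (v : ({0}ᶜ : Set V)) :
      ((homeomorphUnitSphereProd V v).2 : ℝ) • ((homeomorphUnitSphereProd V v).1 : V) = v :=
    congrArg Subtype.val ((homeomorphUnitSphereProd V).symm_apply_apply v)
  have := measurable_lintegral_sphere (μ := μ) hg y₀
  calc ∫⁻ y, g y ∂μ = ∫⁻ v, g (y₀ + v) ∂μ := (lintegral_add_left_eq_self g y₀).symm
    _ = ∫⁻ v : ({0}ᶜ : Set V), g (y₀ + v) ∂(μ.comap Subtype.val) := by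
        rw [lintegral_subtype_comap (measurableSet_singleton _).compl (fun v => g (y₀ + v)),
          restrict_compl_singleton]
    _ = ∫⁻ p : sphere (0 : V) 1 × Ioi (0 : ℝ), g (y₀ + (p.2 : ℝ) • (p.1 : V))
          ∂(μ.toSphere.prod (.volumeIoiPow (finrank ℝ V - 1))) := by
        rw [← μ.measurePreserving_homeomorphUnitSphereProd.lintegral_comp (by fun_prop)]
        simp only [hsymm]
    _ = ∫⁻ r : Ioi (0 : ℝ), ∫⁻ θ, g (y₀ + (r : ℝ) • (θ : V)) ∂μ.toSphere
          ∂(.volumeIoiPow (finrank ℝ V - 1)) := lintegral_prod_symm' _ (by fun_prop)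
    _ = _ := by
        rw [Measure.volumeIoiPow, ← lintegral_subtype_comap measurableSet_Ioi,
          lintegral_withDensity_eq_lintegral_mul _ (by fun_prop) (by fun_prop)]
        rfl

theorem ae_ae_sphere_of_ae [Nontrivial V] {p : V → Prop} (hp : ∀ᵐ y ∂μ, p y) (y₀ : V) :
    ∀ᵐ r ∂volume.restrict (Ioi (0 : ℝ)), ∀ᵐ θ : sphere (0 : V) 1 ∂μ.toSphere,
      p (y₀ + r • (θ : V)) := by
  obtain ⟨N, hpN, hN, hN0⟩ := exists_measurable_superset_of_null (ae_iff.1 hp)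
  have hg : Measurable (N.indicator (1 : V → ℝ≥0∞)) := measurable_one.indicator hN
  have := measurable_lintegral_sphere (μ := μ) hg y₀
  rw [← lintegral_indicator_one hN, lintegral_polar hg y₀,
    lintegral_eq_zero_iff (by fun_prop)] at hN0
  filter_upwards [hN0, ae_restrict_mem measurableSet_Ioi] with r hr (hr0 : 0 < r)
  have hrN := (mul_eq_zero.1 hr).resolve_left (by simpa using pow_pos hr0 _)
  rw [lintegral_eq_zero_iff (by fun_prop)] at hrN
  filter_upwards [hrN] with θ hθ
  by_contra hpθ
  simp [show y₀ + r • (θ : V) ∈ N from hpN hpθ] at hθ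

theorem ofReal_mul_toSphere_closedBall_le [Nontrivial V] (x : sphere (0 : V) 1) (d : ℝ) :
    ENNReal.ofReal d * μ.toSphere (closedBall x d) ≤ μ (closedBall (x : V) (2 * d)) := by
  set F : V → ℝ≥0∞ := (closedBall (x : V) (2 * d)).indicator 1
  calc ENNReal.ofReal d * μ.toSphere (closedBall x d)
      = ∫⁻ _ in Icc 1 (1 + d), μ.toSphere (closedBall x d) := by
        rw [setLIntegral_const, Real.volume_Icc, add_sub_cancel_left, mul_comm]
    _ ≤ ∫⁻ r in Icc 1 (1 + d), ENNReal.ofReal (r ^ (finrank ℝ V - 1)) *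
          ∫⁻ θ, F (0 + r • (θ : V)) ∂μ.toSphere := by
        refine setLIntegral_mono' measurableSet_Icc fun r hr => ?_
        rw [← one_mul (μ.toSphere _), ← lintegral_indicator_one measurableSet_closedBall]
        refine mul_le_mul' (ENNReal.one_le_ofReal.2 (one_le_pow₀ hr.1)) (lintegral_mono ?_)
        refine indicator_le fun θ hθ => ?_
        rw [zero_add]
        exact (indicator_of_mem (smul_mem_closedBall_two_mul hr hθ) (1 : V → ℝ≥0∞)).ge
    _ ≤ ∫⁻ r in Ioi 0, ENNReal.ofReal (r ^ (finrank ℝ V - 1)) *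
          ∫⁻ θ, F (0 + r • (θ : V)) ∂μ.toSphere :=
        lintegral_mono_set fun r hr => one_pos.trans_le hr.1
    _ = μ (closedBall (x : V) (2 * d)) := by
        rw [← lintegral_polar (measurable_one.indicator measurableSet_closedBall),
          lintegral_indicator_one measurableSet_closedBall]

theorem toSphere_closedBall_le [Nontrivial V] (x : sphere (0 : V) 1) {d : ℝ} (hd : 0 < d) :
    μ.toSphere (closedBall x d) ≤
      ENNReal.ofReal (2 ^ finrank ℝ V) * μ (ball 0 1) * ENNReal.ofReal d ^ (finrank ℝ V - 1) := by
  have hshell := ofReal_mul_toSphere_closedBall_le (μ := μ) x d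
  have hd0 : ENNReal.ofReal d ≠ 0 := by simpa using hd
  rw [Measure.addHaar_closedBall _ _ (by positivity), mul_pow, ENNReal.ofReal_mul (by positivity),
    ENNReal.ofReal_pow hd.le] at hshell
  obtain ⟨k, hk⟩ := Nat.exists_eq_add_one.2 (finrank_pos (R := ℝ) (M := V))
  rw [← ENNReal.mul_le_mul_iff_right hd0 ENNReal.ofReal_ne_top]
  refine hshell.trans_eq ?_
  rw [hk, add_tsub_cancel_right]
  ring

end PolarCoordinates

section HausdorffMeasure

theorem le_smul_hausdorffMeasure {X : Type*} [MetricSpace X] [MeasurableSpace X] [BorelSpace X]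
    {ν : Measure X} {C : ℝ≥0∞} (hC0 : C ≠ 0) (hC : C ≠ ∞) {d ε : ℝ} (hε : 0 < ε)
    (hν : ∀ x, ∀ r ∈ Ioo 0 ε, ν (closedBall x r) ≤ C * ENNReal.ofReal r ^ d) :
    ν ≤ C • μH[d] := by
  suffices h : C⁻¹ • ν ≤ μH[d] by
    intro s
    simpa [ENNReal.inv_mul_le_iff hC0 hC] using h s
  refine Measure.le_mkMetric _ _ (ENNReal.ofReal (ε / 2)) (by simpa using hε) fun s hs => ?_
  rw [Measure.smul_apply, smul_eq_mul, ENNReal.inv_mul_le_iff hC0 hC]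
  obtain rfl | ⟨x, hx⟩ := s.eq_empty_or_nonempty
  · simp
  have hfin : ediam s ≠ ∞ := ne_top_of_le_ne_top ENNReal.ofReal_ne_top hs
  have hlt : diam s < ε :=
    (ENNReal.toReal_le_of_le_ofReal (half_pos hε).le hs).trans_lt (half_lt_self hε)
  have hlim : Tendsto (fun r : ℝ => C * ENNReal.ofReal r ^ d) (𝓝[>] (diam s))
      (𝓝 (C * ENNReal.ofReal (diam s) ^ d)) :=
    ENNReal.Tendsto.const_mul (((ENNReal.continuous_rpow_const.comp
      ENNReal.continuous_ofReal).tendsto _).mono_left nhdsWithin_le_nhds) (Or.inr hC)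
  rw [diam, ENNReal.ofReal_toReal hfin] at hlim
  refine ge_of_tendsto hlim ?_
  filter_upwards [Ioo_mem_nhdsGT hlt] with r hr
  refine (measure_mono fun y hy => ?_).trans (hν x r ⟨diam_nonneg.trans_lt hr.1, hr.2⟩)
  exact (dist_le_diam_of_mem' hfin hy hx).trans hr.1.le

variable {V : Type*} [NormedAddCommGroup V] [NormedSpace ℝ V] [FiniteDimensional ℝ V]
  [MeasurableSpace V] [BorelSpace V] (μ : Measure V) [μ.IsAddHaarMeasure]

theorem exists_toSphere_le_smul_hausdorffMeasure [Nontrivial V] :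
    ∃ C : ℝ≥0∞, C ≠ ∞ ∧ μ.toSphere ≤ C • μH[(finrank ℝ V : ℝ) - 1] := by
  refine ⟨ENNReal.ofReal (2 ^ finrank ℝ V) * μ (ball 0 1), ?_, ?_⟩
  · exact ENNReal.mul_ne_top ENNReal.ofReal_ne_top measure_ball_lt_top.ne
  refine le_smul_hausdorffMeasure (mul_ne_zero (by simp) (measure_ball_pos _ _ one_pos).ne')
    (ENNReal.mul_ne_top ENNReal.ofReal_ne_top measure_ball_lt_top.ne) one_pos fun x r hr => ?_
  rw [← Nat.cast_pred finrank_pos, ENNReal.rpow_natCast]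
  exact toSphere_closedBall_le x hr.1

theorem exists_lintegral_toSphere_le [Nontrivial V] (y₀ : V) {r : ℝ} (hr : 0 < r) :
    ∃ C : ℝ≥0∞, C ≠ ∞ ∧ ∀ g : V → ℝ≥0∞, ∫⁻ θ, g (y₀ + r • (θ : V)) ∂μ.toSphere ≤
      C * ∫⁻ y in sphere y₀ r, g y ∂μH[(finrank ℝ V : ℝ) - 1] := by
  obtain ⟨C, hC, hle⟩ := exists_toSphere_le_smul_hausdorffMeasure μ
  set d : ℝ := (finrank ℝ V : ℝ) - 1
  have hd : 0 ≤ d := sub_nonneg.2 (mod_cast finrank_pos (R := ℝ) (M := V))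
  set φ : sphere (0 : V) 1 → V := fun θ => y₀ + r • (θ : V) with hφ
  have hanti : AntilipschitzWith r⁻¹.toNNReal φ := .of_le_mul_dist fun a b => by
    rw [hφ, dist_add_left, dist_smul₀, Real.norm_of_nonneg hr.le,
      Real.coe_toNNReal _ (by positivity), inv_mul_cancel_left₀ hr.ne', Subtype.dist_eq]
  have hemb : MeasurableEmbedding φ := Continuous.measurableEmbedding (by fun_prop) hanti.injective
  have hmap : μ.toSphere.map φ ≤ (C * (r⁻¹.toNNReal : ℝ≥0∞) ^ d) • μH[d] := Measure.le_intro
    fun s _ _ => by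
      rw [hemb.map_apply, Measure.smul_apply, smul_eq_mul, mul_assoc]
      grw [hle (φ ⁻¹' s), Measure.smul_apply, smul_eq_mul, hanti.hausdorffMeasure_preimage_le hd]
  have hsphere : ∀ᵐ y ∂μ.toSphere.map φ, y ∈ sphere y₀ r :=
    hemb.ae_map_iff.2 (.of_forall fun θ => by simp [φ, norm_smul, abs_of_pos hr])
  refine ⟨C * (r⁻¹.toNNReal : ℝ≥0∞) ^ d, by finiteness, fun g => ?_⟩
  calc ∫⁻ θ, g (φ θ) ∂μ.toSphere = ∫⁻ y in sphere y₀ r, g y ∂μ.toSphere.map φ := by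
        rw [← hemb.lintegral_map, Measure.restrict_eq_self_of_ae_mem hsphere]
    _ ≤ ∫⁻ y in sphere y₀ r, g y ∂((C * (r⁻¹.toNNReal : ℝ≥0∞) ^ d) • μH[d]) := by gcongr
    _ = C * (r⁻¹.toNNReal : ℝ≥0∞) ^ d * ∫⁻ y in sphere y₀ r, g y ∂μH[d] := by
        rw [Measure.restrict_smul, lintegral_smul_measure, smul_eq_mul]

end HausdorffMeasure

theorem exists_measurableSet_forall_le_natCast {α : Type*} [MeasurableSpace α] {ν : Measure α}
    {q : α → ℝ≥0∞} (hq : Measurable q) {s : Set α} (hs : NullMeasurableSet s ν) (hs0 : ν s ≠ 0)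
    (hfin : ∀ᵐ x ∂ν, x ∈ s → q x < ∞) :
    ∃ t ⊆ s, MeasurableSet t ∧ ν t ≠ 0 ∧ ∃ N : ℕ, ∀ x ∈ t, q x ≤ N := by
  obtain ⟨N, hN⟩ : ∃ N : ℕ, ν ({x | q x ≤ N} ∩ s) ≠ 0 := by
    by_contra! hnull
    refine hs0 (measure_mono_null_ae ?_ (measure_iUnion_null hnull))
    filter_upwards [hfin] with x hx hxs
    obtain ⟨N, hN⟩ := ENNReal.exists_nat_gt (hx hxs).ne
    exact mem_iUnion.2 ⟨N, hN.le, hxs⟩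
  obtain ⟨t, hts, ht, hae⟩ :=
    ((hq measurableSet_Iic).nullMeasurableSet.inter hs).exists_measurable_subset_ae_eq
  exact ⟨t, fun x hx => (hts hx).2, ht, (measure_congr hae).trans_ne hN, N, fun x hx => (hts hx).1⟩

section Weight

variable {V : Type*} [NormedAddCommGroup V] [NormedSpace ℝ V] [FiniteDimensional ℝ V]
  [MeasurableSpace V] [BorelSpace V] {μ : Measure V} [μ.IsAddHaarMeasure]

theorem lintegral_mul_comp_dist [Nontrivial V] {g : V → ℝ≥0∞} (hg : Measurable g)
    {w : ℝ → ℝ≥0∞} (hw : Measurable w) (y₀ : V) :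
    ∫⁻ y, g y * w (dist y y₀) ∂μ =
      ∫⁻ r in Ioi (0 : ℝ), ENNReal.ofReal (r ^ (finrank ℝ V - 1)) *
        ((∫⁻ θ, g (y₀ + r • (θ : V)) ∂μ.toSphere) * w r) := by
  rw [lintegral_polar (by fun_prop) y₀]
  refine setLIntegral_congr_fun measurableSet_Ioi fun r (hr : 0 < r) => ?_
  rw [← lintegral_mul_const _ (by fun_prop)]
  simp [norm_smul, abs_of_pos hr]

theorem lintegral_mul_indicator_comp_dist_lt_top [Nontrivial V] {g : V → ℝ≥0∞} (hg : Measurable g)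
    (y₀ : V) {r₂ : ℝ} {F : Set ℝ} (hFm : MeasurableSet F) (hF : F ⊆ Icc 0 r₂) {N c : ℝ≥0∞}
    (hN : N ≠ ∞) (hgN : ∀ r ∈ F, ∫⁻ θ, g (y₀ + r • (θ : V)) ∂μ.toSphere ≤ N) (hc : c ≠ ∞) :
    ∫⁻ y, g y * F.indicator (fun _ => c) (dist y y₀) ∂μ < ∞ := by
  calc ∫⁻ y, g y * F.indicator (fun _ => c) (dist y y₀) ∂μ
      = ∫⁻ r in Ioi (0 : ℝ), ENNReal.ofReal (r ^ (finrank ℝ V - 1)) *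
          ((∫⁻ θ, g (y₀ + r • (θ : V)) ∂μ.toSphere) * F.indicator (fun _ => c) r) :=
        lintegral_mul_comp_dist hg (measurable_const.indicator hFm) y₀
    _ ≤ ∫⁻ r, F.indicator (fun _ => ENNReal.ofReal (r₂ ^ (finrank ℝ V - 1)) * (N * c)) r := by
        refine (setLIntegral_le_lintegral _ _).trans (lintegral_mono fun r => ?_)
        by_cases hr : r ∈ F
        · have hr0 : 0 ≤ r := (hF hr).1
          simp only [indicator_of_mem hr]
          grw [(hF hr).2, hgN r hr]
        · simp [hr]
    _ = ENNReal.ofReal (r₂ ^ (finrank ℝ V - 1)) * (N * c) * volume F :=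
        lintegral_indicator_const hFm _
    _ < ∞ := by
        have : volume F ≠ ∞ := measure_ne_top_of_subset hF measure_Icc_lt_top.ne
        finiteness

theorem exists_weight_lintegral_mul_lt_top [Nontrivial V] {Q : V → ℝ≥0∞} (hQ : AEMeasurable Q μ)
    (y₀ : V) {r₁ r₂ : ℝ} (h₁ : 0 < r₁) {s : Set ℝ} (hs : s ⊆ Icc r₁ r₂)
    (hsm : NullMeasurableSet s) (hs0 : volume s ≠ 0)
    (hfin : ∀ r ∈ s, ∫⁻ y in sphere y₀ r, Q y ∂μH[(finrank ℝ V : ℝ) - 1] < ∞)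
    {p : ℕ} (hp : p ≠ 0) :
    ∃ η : ℝ → ℝ≥0∞, Measurable η ∧ 1 ≤ ∫⁻ r in Ioo r₁ r₂, η r ∧
      ∫⁻ y, Q y * η (dist y y₀) ^ p ∂μ < ∞ := by
  have hQ'm : Measurable (hQ.mk Q) := hQ.measurable_mk
  set Q' := hQ.mk Q
  set q : ℝ → ℝ≥0∞ := fun r => ∫⁻ θ, Q' (y₀ + r • (θ : V)) ∂μ.toSphere
  have hq : ∀ᵐ r, r ∈ s → q r < ∞ := by
    filter_upwards [(ae_restrict_iff' measurableSet_Ioi).1 (ae_ae_sphere_of_ae hQ.ae_eq_mk y₀)]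
      with r hQQ' hr
    have hr0 : 0 < r := h₁.trans_le (hs hr).1
    obtain ⟨C, hC, hle⟩ := exists_lintegral_toSphere_le μ y₀ hr0
    calc q r = ∫⁻ θ, Q (y₀ + r • (θ : V)) ∂μ.toSphere := lintegral_congr_ae ((hQQ' hr0).mono
          fun _ h => h.symm)
      _ < ∞ := (hle Q).trans_lt (ENNReal.mul_lt_top hC.lt_top (hfin r hr))
  obtain ⟨F, hFs, hFm, hF0, N, hN⟩ := exists_measurableSet_forall_le_natCast
    (measurable_lintegral_sphere hQ'm y₀) hsm hs0 hq
  have hF : F ⊆ Icc r₁ r₂ := hFs.trans hs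
  have hFfin : volume F ≠ ∞ := measure_ne_top_of_subset hF measure_Icc_lt_top.ne
  refine ⟨F.indicator fun _ => (volume F)⁻¹, measurable_const.indicator hFm, ?_, ?_⟩
  · rw [setLIntegral_congr Ioo_ae_eq_Icc, lintegral_indicator_const hFm,
      Measure.restrict_apply hFm, inter_eq_left.2 hF, ENNReal.inv_mul_cancel hF0 hFfin]
  calc ∫⁻ y, Q y * F.indicator (fun _ => (volume F)⁻¹) (dist y y₀) ^ p ∂μ
      = ∫⁻ y, Q' y * F.indicator (fun _ => (volume F)⁻¹ ^ p) (dist y y₀) ∂μ := by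
        refine lintegral_congr_ae (hQ.ae_eq_mk.mul (.of_forall fun y => ?_))
        by_cases hy : dist y y₀ ∈ F <;> simp [hy, hp]
    _ < ∞ := lintegral_mul_indicator_comp_dist_lt_top hQ'm y₀ hFm
        (hF.trans (Icc_subset_Icc_left h₁.le)) (ENNReal.natCast_ne_top N) hN
        (ENNReal.pow_ne_top (ENNReal.inv_ne_top.2 hF0))

end Weight

section SphereEstimate

variable {V : Type*} [NormedAddCommGroup V] [NormedSpace ℝ V]

/-- The broken line through `x`, `z` and `y`, which it passes at the times `-1`, `0` and `1`. -/
def brokenLine (x z y : V) (τ : ℝ) : V := max (-τ) 0 • x + max τ 0 • y + (1 - |τ|) • z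

theorem brokenLine_neg_one (x z y : V) : brokenLine x z y (-1) = x := by simp [brokenLine]

theorem brokenLine_one (x z y : V) : brokenLine x z y 1 = y := by simp [brokenLine]

theorem norm_max_smul_add_max_smul_le {x y : V} (hx : ‖x‖ ≤ 1) (hy : ‖y‖ ≤ 1) (τ : ℝ) :
    ‖max (-τ) 0 • x + max τ 0 • y‖ ≤ |τ| := by
  rcases le_total τ 0 with h | h
  · simpa [h, norm_smul] using mul_le_of_le_one_right (abs_nonneg τ) hx
  · simpa [h, norm_smul] using mul_le_of_le_one_right (abs_nonneg τ) hy

theorem lipschitzWith_brokenLine {x z y : V} (hx : ‖x‖ ≤ 1) (hz : ‖z‖ ≤ 2) (hy : ‖y‖ ≤ 1) :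
    LipschitzWith 4 (brokenLine x z y) := by
  refine LipschitzWith.of_dist_le_mul fun τ τ' => ?_
  have h1 : |max (-τ) 0 - max (-τ') 0| ≤ |τ - τ'| := by
    simpa [abs_sub_comm, neg_add_eq_sub] using abs_max_sub_max_le_abs (-τ) (-τ') 0
  have h2 : |max τ 0 - max τ' 0| ≤ |τ - τ'| := abs_max_sub_max_le_abs τ τ' 0
  have h3 : |(|τ'| - |τ|)| ≤ |τ - τ'| := abs_sub_comm τ τ' ▸ abs_abs_sub_abs_le_abs_sub τ' τ
  rw [dist_eq_norm, Real.dist_eq]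
  calc ‖brokenLine x z y τ - brokenLine x z y τ'‖
      = ‖(max (-τ) 0 - max (-τ') 0) • x + (max τ 0 - max τ' 0) • y + (|τ'| - |τ|) • z‖ := by
        congr 1; unfold brokenLine; module
    _ ≤ |τ - τ'| * 1 + |τ - τ'| * 1 + |τ - τ'| * 2 := by
        grw [norm_add₃_le, norm_smul, norm_smul, norm_smul, Real.norm_eq_abs, Real.norm_eq_abs,
          Real.norm_eq_abs, h1, h2, h3, hx, hy, hz]
    _ = (4 : ℝ≥0) * |τ - τ'| := by norm_num; ring

theorem norm_mul_norm_normalize_sub_normalize_le {u v : V} (hv : v ≠ 0) :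
    ‖u‖ * ‖normalize u - normalize v‖ ≤ 2 * ‖u - v‖ :=
  calc ‖u‖ * ‖normalize u - normalize v‖ = ‖‖u‖ • (normalize u - normalize v)‖ := by
        rw [norm_smul, norm_norm]
    _ = ‖(u - v) + (‖v‖ - ‖u‖) • normalize v‖ := by
        rw [smul_sub, norm_smul_normalize, sub_smul, norm_smul_normalize]; congr 1; module
    _ ≤ ‖u - v‖ + |‖v‖ - ‖u‖| * 1 := by
        grw [norm_add_le, norm_smul, Real.norm_eq_abs, norm_normalize_eq_one_iff.2 hv]
    _ ≤ 2 * ‖u - v‖ := by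
        grw [abs_sub_comm, abs_norm_sub_norm_le]; linarith

theorem lintegral_one_sub_abs_rpow_lt_top {β : ℝ} (hβ : β < 1) :
    ∫⁻ τ in Icc (-1 : ℝ) 1, ENNReal.ofReal ((1 - |τ|) ^ (-β)) < ∞ := by
  have h0 : IntervalIntegrable (fun x : ℝ => x ^ (-β)) volume 0 2 :=
    intervalIntegral.intervalIntegrable_rpow' (by linarith)
  have h1 : IntegrableOn (fun τ : ℝ => (1 + τ) ^ (-β)) (Icc (-1) 1) := by
    have := h0.comp_add_left 1
    norm_num at this
    rwa [intervalIntegrable_iff_integrableOn_Icc_of_le (by norm_num)] at this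
  have h2 : IntegrableOn (fun τ : ℝ => (1 - τ) ^ (-β)) (Icc (-1) 1) := by
    have := (h0.comp_sub_left 1).symm
    norm_num at this
    rwa [intervalIntegrable_iff_integrableOn_Icc_of_le (by norm_num)] at this
  refine lt_of_le_of_lt (setLIntegral_mono' measurableSet_Icc fun τ hτ => ?_)
    (h1.add h2).lintegral_lt_top
  refine ENNReal.ofReal_le_ofReal ?_
  have h3 : 0 ≤ (1 + τ) ^ (-β) := Real.rpow_nonneg (by linarith [hτ.1]) _
  have h4 : 0 ≤ (1 - τ) ^ (-β) := Real.rpow_nonneg (by linarith [hτ.2]) _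
  rcases abs_cases τ with ⟨h, -⟩ | ⟨h, -⟩ <;> simp only [Pi.add_apply, h, sub_neg_eq_add] <;>
    linarith

theorem lt_norm_add_of_smul_mem_ball {θ : sphere (0 : V) 1} {w : V} {r s : ℝ}
    (h : r • (θ : V) ∈ ball w s) : r < ‖w‖ + s := by
  have hnorm := norm_le_norm_add_norm_sub' (r • (θ : V)) w
  rw [norm_smul, norm_eq_of_mem_sphere, mul_one, Real.norm_eq_abs, ← dist_eq_norm] at hnorm
  linarith [le_abs_self r, mem_ball.1 h]

theorem volume_smul_mem_ball_le (θ : sphere (0 : V) 1) (w : V) (s : ℝ) :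
    volume {r : ℝ | r • (θ : V) ∈ ball w s} ≤ ENNReal.ofReal (2 * s) := by
  refine (Real.volume_le_diam _).trans (ediam_le fun r hr r' hr' => ?_)
  have hdist : dist (r • (θ : V)) (r' • (θ : V)) = dist r r' := by
    rw [dist_eq_norm, ← sub_smul, norm_smul, norm_eq_of_mem_sphere, mul_one, ← dist_eq_norm]
  rw [edist_dist, ← hdist]
  refine ENNReal.ofReal_le_ofReal ((dist_triangle_right _ _ w).trans ?_)
  linarith [mem_ball.1 hr, mem_ball.1 hr']

theorem lintegral_le_lintegral_pow_rpow {α : Type*} [MeasurableSpace α] {ν : Measure α}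
    {f : α → ℝ≥0∞} (hf : AEMeasurable f ν) {p : ℕ} (hp : 1 ≤ p) :
    ∫⁻ x, f x ∂ν ≤ (∫⁻ x, f x ^ p ∂ν) ^ (1 / p : ℝ) * ν univ ^ (1 - 1 / p : ℝ) := by
  simpa [eLpNorm'] using eLpNorm'_le_eLpNorm'_mul_rpow_measure_univ one_pos
    (show (1 : ℝ) ≤ p from mod_cast hp) hf.aestronglyMeasurable

variable [FiniteDimensional ℝ V] [MeasurableSpace V] [BorelSpace V] {μ : Measure V}
  [μ.IsAddHaarMeasure]

theorem measurable_normalize : Measurable (NormedSpace.normalize : V → V) := by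
  unfold NormedSpace.normalize
  fun_prop

theorem lintegral_lintegral_mul_indicator {α β : Type*} [MeasurableSpace α] [MeasurableSpace β]
    {ν : Measure α} [SFinite ν] {ξ : Measure β} [SFinite ξ] {h : β → ℝ≥0∞} (hh : Measurable h)
    {s : Set (α × β)} (hs : MeasurableSet s) :
    ∫⁻ x, ∫⁻ y, h y * s.indicator 1 (x, y) ∂ξ ∂ν = ∫⁻ y, h y * ν ((·, y) ⁻¹' s) ∂ξ := by
  have : Measurable (s.indicator (1 : α × β → ℝ≥0∞)) := measurable_one.indicator hs
  rw [lintegral_lintegral_swap (by fun_prop)]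
  refine lintegral_congr fun y => ?_
  rw [lintegral_const_mul _ (by fun_prop),
    ← lintegral_indicator_one (hs.preimage (by fun_prop : Measurable fun x : α => (x, y)))]
  rfl

theorem lintegral_ball_comp_normalize_le [Nontrivial V] {h : V → ℝ≥0∞} (hh : Measurable h)
    {w : V} {s R : ℝ} (hR : ‖w‖ + s ≤ R) :
    ∫⁻ v in ball w s, h (normalize v) ∂μ ≤
      ENNReal.ofReal (R ^ (finrank ℝ V - 1)) * ENNReal.ofReal (2 * s) * ∫⁻ θ, h θ ∂μ.toSphere := by
  have := measurable_normalize (V := V)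
  set k := finrank ℝ V - 1
  set S : Set (ℝ × sphere (0 : V) 1) := {p | p.1 • (p.2 : V) ∈ ball w s}
  have hS : MeasurableSet S :=
    measurableSet_ball.preimage (f := fun p : ℝ × sphere (0 : V) 1 => p.1 • (p.2 : V))
      (by fun_prop)
  calc ∫⁻ v in ball w s, h (normalize v) ∂μ
      = ∫⁻ r in Ioi (0 : ℝ), ENNReal.ofReal (r ^ k) * ∫⁻ θ,
          (ball w s).indicator (fun v => h (normalize v)) (0 + r • (θ : V)) ∂μ.toSphere := by
        rw [← lintegral_indicator measurableSet_ball]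
        exact lintegral_polar (Measurable.indicator (by fun_prop) measurableSet_ball) 0
    _ ≤ ∫⁻ r in Ioi (0 : ℝ), ENNReal.ofReal (R ^ k) *
          ∫⁻ θ, h θ * S.indicator 1 (r, θ) ∂μ.toSphere := by
        refine setLIntegral_mono' measurableSet_Ioi fun r (hr : 0 < r) => ?_
        rw [← lintegral_const_mul' _ _ ENNReal.ofReal_ne_top,
          ← lintegral_const_mul' _ _ ENNReal.ofReal_ne_top]
        refine lintegral_mono fun θ => ?_
        rw [zero_add]
        by_cases hθ : r • (θ : V) ∈ ball w s
        · have hθS : S.indicator (1 : ℝ × sphere (0 : V) 1 → ℝ≥0∞) (r, θ) = 1 :=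
            indicator_of_mem hθ 1
          rw [indicator_of_mem hθ, normalize_smul_of_pos hr,
            normalize_eq_self_of_norm_eq_one (norm_eq_of_mem_sphere θ), hθS, mul_one]
          grw [(lt_norm_add_of_smul_mem_ball hθ).le.trans hR]
        · rw [indicator_of_notMem hθ, mul_zero]
          exact zero_le
    _ ≤ ENNReal.ofReal (R ^ k) * ∫⁻ r, ∫⁻ θ, h θ * S.indicator 1 (r, θ) ∂μ.toSphere := by
        rw [lintegral_const_mul' _ _ ENNReal.ofReal_ne_top]
        exact mul_le_mul_right (setLIntegral_le_lintegral _ _) _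
    _ ≤ ENNReal.ofReal (R ^ k) * ∫⁻ θ, h θ * ENNReal.ofReal (2 * s) ∂μ.toSphere := by
        rw [lintegral_lintegral_mul_indicator (h := fun θ : sphere (0 : V) 1 => h θ)
          (by fun_prop) hS]
        gcongr with θ
        exact volume_smul_mem_ball_le θ w s
    _ = ENNReal.ofReal (R ^ k) * ENNReal.ofReal (2 * s) * ∫⁻ θ, h θ ∂μ.toSphere := by
        rw [lintegral_mul_const' _ _ ENNReal.ofReal_ne_top, mul_comm (lintegral _ _), mul_assoc]

theorem setLIntegral_ball_comp_add_smul {F : V → ℝ≥0∞} (hF : Measurable F) (q z₀ : V) {t : ℝ}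
    (ht : 0 < t) (s : ℝ) :
    ∫⁻ z in ball z₀ s, F (q + t • z) ∂μ =
      ENNReal.ofReal (t ^ finrank ℝ V)⁻¹ * ∫⁻ v in ball (q + t • z₀) (t * s), F v ∂μ := by
  have hball : ball z₀ s = (fun z => q + t • z) ⁻¹' ball (q + t • z₀) (t * s) := by
    ext z
    rw [mem_preimage, mem_ball, mem_ball, dist_add_left, dist_smul₀, Real.norm_of_nonneg ht.le,
      mul_lt_mul_iff_right₀ ht]
  have hG : Measurable ((ball (q + t • z₀) (t * s)).indicator F) := hF.indicator measurableSet_ball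
  set G := (ball (q + t • z₀) (t * s)).indicator F with hGdef
  calc ∫⁻ z in ball z₀ s, F (q + t • z) ∂μ = ∫⁻ z, G (q + t • z) ∂μ := by
        rw [← lintegral_indicator measurableSet_ball, hball]
        rfl
    _ = ∫⁻ z, G (q + z) ∂μ.map (t • ·) :=
        (lintegral_map (f := fun z => G (q + z)) (by fun_prop) (by fun_prop)).symm
    _ = ENNReal.ofReal (t ^ finrank ℝ V)⁻¹ * ∫⁻ v, G v ∂μ := by
        rw [Measure.map_addHaar_smul μ ht.ne', lintegral_smul_measure, smul_eq_mul,
          lintegral_add_left_eq_self G q, abs_of_pos (by positivity)]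
    _ = _ := by rw [hGdef, lintegral_indicator measurableSet_ball]

theorem lintegral_ball_comp_normalize_add_smul_le [Nontrivial V] {h : V → ℝ≥0∞}
    (hh : Measurable h) {q z₀ : V} (hz₀ : ‖z₀‖ ≤ 1) {t : ℝ} (ht : 0 < t) (hq : ‖q‖ ≤ 1 - t) :
    ∫⁻ z in ball z₀ (1 / 4), h (normalize (q + t • z)) ∂μ ≤
      (ENNReal.ofReal (2 ^ (finrank ℝ V - 1)) * ∫⁻ θ, h θ ^ finrank ℝ V ∂μ.toSphere) ^
          (1 / finrank ℝ V : ℝ) * μ (ball 0 (1 / 4)) ^ (1 - 1 / finrank ℝ V : ℝ) *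
        ENNReal.ofReal (t ^ (-(1 - 1 / finrank ℝ V : ℝ))) := by
  have := measurable_normalize (V := V)
  have hd : 1 ≤ finrank ℝ V := finrank_pos
  have hnorm : ‖q + t • z₀‖ + t * (1 / 4) ≤ 2 := by
    grw [norm_add_le, norm_smul, Real.norm_of_nonneg ht.le, hz₀, hq]
    linarith [(norm_nonneg q).trans hq]
  set d := finrank ℝ V
  set S := ∫⁻ θ, h θ ^ d ∂μ.toSphere
  have hpow : ∫⁻ z in ball z₀ (1 / 4), h (normalize (q + t • z)) ^ d ∂μ ≤
      ENNReal.ofReal (2 ^ (d - 1)) * S * ENNReal.ofReal (t ^ (1 - d : ℝ)) :=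
    calc ∫⁻ z in ball z₀ (1 / 4), h (normalize (q + t • z)) ^ d ∂μ
        = ENNReal.ofReal (t ^ d)⁻¹ *
            ∫⁻ v in ball (q + t • z₀) (t * (1 / 4)), h (normalize v) ^ d ∂μ :=
          setLIntegral_ball_comp_add_smul (F := fun v => h (normalize v) ^ d) (by fun_prop) q z₀
            ht _
      _ ≤ ENNReal.ofReal (t ^ d)⁻¹ * (ENNReal.ofReal (2 ^ (d - 1)) *
            ENNReal.ofReal (2 * (t * (1 / 4))) * S) := by
          gcongr
          exact lintegral_ball_comp_normalize_le (hh.pow_const d) hnorm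
      _ = ENNReal.ofReal (2 ^ (d - 1)) * S * ENNReal.ofReal ((t ^ d)⁻¹ * (2 * (t * (1 / 4)))) := by
          rw [ENNReal.ofReal_mul (p := (t ^ d)⁻¹) (by positivity)]
          ring
      _ ≤ ENNReal.ofReal (2 ^ (d - 1)) * S * ENNReal.ofReal (t ^ (1 - d : ℝ)) := by
          gcongr
          have hle : 2 * (t * (1 / 4)) ≤ t := by linarith
          rw [Real.rpow_sub ht, Real.rpow_one, Real.rpow_natCast, div_eq_inv_mul t]
          gcongr
  have hexp : (1 - d : ℝ) * (1 / d) = -(1 - 1 / d) := by field_simp; ring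
  have hd0 : (0 : ℝ) ≤ 1 / d := by positivity
  have hvol : (μ.restrict (ball z₀ (1 / 4))) univ = μ (ball 0 (1 / 4)) := by
    rw [Measure.restrict_apply_univ, Measure.addHaar_ball_center]
  grw [lintegral_le_lintegral_pow_rpow (by fun_prop) hd, hpow, hvol,
    ENNReal.mul_rpow_of_nonneg _ _ hd0, ENNReal.ofReal_rpow_of_pos (by positivity),
    ← Real.rpow_mul ht.le, hexp, mul_right_comm]

theorem measure_ball_le_of_one_le_lintegral_brokenLine [Nontrivial V] {h : V → ℝ≥0∞}
    {x y z₀ : V} (hh : Measurable h) (hx : ‖x‖ ≤ 1) (hy : ‖y‖ ≤ 1) (hz₀ : ‖z₀‖ ≤ 1)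
    (hadm : ∀ z ∈ ball z₀ (1 / 4), 1 ≤ ∫⁻ τ in Icc (-1) 1, h (normalize (brokenLine x z y τ))) :
    μ (ball 0 (1 / 4)) ≤
      (ENNReal.ofReal (2 ^ (finrank ℝ V - 1)) * ∫⁻ θ, h θ ^ finrank ℝ V ∂μ.toSphere) ^
          (1 / finrank ℝ V : ℝ) * (μ (ball 0 (1 / 4)) ^ (1 - 1 / finrank ℝ V : ℝ) *
        ∫⁻ τ in Icc (-1 : ℝ) 1, ENNReal.ofReal ((1 - |τ|) ^ (-(1 - 1 / finrank ℝ V : ℝ)))) := by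
  have := measurable_normalize (V := V)
  have hslice (τ : ℝ) (hτ : τ ∈ Ioo (-1 : ℝ) 1) :=
    lintegral_ball_comp_normalize_add_smul_le (μ := μ) (q := max (-τ) 0 • x + max τ 0 • y) hh hz₀
      (t := 1 - |τ|) (by linarith [abs_lt.2 hτ])
      (by simpa using norm_max_smul_add_max_smul_le hx hy τ)
  -- Average the hypothesis over the middle vertex `z`, and interchange the integrations.
  calc μ (ball 0 (1 / 4)) = ∫⁻ _ in ball z₀ (1 / 4), 1 ∂μ := by
        rw [setLIntegral_one, Measure.addHaar_ball_center μ z₀]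
    _ ≤ ∫⁻ z in ball z₀ (1 / 4), (∫⁻ τ in Icc (-1) 1, h (normalize (brokenLine x z y τ))) ∂μ :=
        setLIntegral_mono' measurableSet_ball hadm
    _ = ∫⁻ τ in Ioo (-1 : ℝ) 1, ∫⁻ z in ball z₀ (1 / 4),
          h (normalize (brokenLine x z y τ)) ∂μ := by
        rw [lintegral_lintegral_swap (by unfold brokenLine; fun_prop),
          setLIntegral_congr Ioo_ae_eq_Icc]
    _ ≤ _ := setLIntegral_mono' measurableSet_Ioo hslice
    _ = _ := by
        rw [lintegral_const_mul _ (by fun_prop), mul_assoc, setLIntegral_congr Ioo_ae_eq_Icc]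

theorem exists_le_lintegral_toSphere_pow [Nontrivial V] :
    ∃ c : ℝ≥0∞, c ≠ 0 ∧ ∀ {h : V → ℝ≥0∞} {x y z₀ : V}, Measurable h → ‖x‖ ≤ 1 → ‖y‖ ≤ 1 →
      ‖z₀‖ ≤ 1 → (∀ z ∈ ball z₀ (1 / 4),
        1 ≤ ∫⁻ τ in Icc (-1) 1, h (normalize (brokenLine x z y τ))) →
      c ≤ ∫⁻ θ, h θ ^ finrank ℝ V ∂μ.toSphere := by
  have hd : 0 < finrank ℝ V := finrank_pos
  set d := finrank ℝ V
  set β : ℝ := 1 - 1 / d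
  have hdR : (0 : ℝ) < d := mod_cast hd
  have hβ : β < 1 := sub_lt_self 1 (by positivity)
  set ω := μ (ball (0 : V) (1 / 4))
  set T := ∫⁻ τ in Icc (-1 : ℝ) 1, ENNReal.ofReal ((1 - |τ|) ^ (-β))
  have hω0 : ω ≠ 0 := (measure_ball_pos μ 0 (by norm_num)).ne'
  have hω : ω ≠ ∞ := measure_ball_lt_top.ne
  have hT : T ≠ ∞ := (lintegral_one_sub_abs_rpow_lt_top hβ).ne
  have hC : ω ^ β * T ≠ ∞ := by finiteness
  have h2 : ENNReal.ofReal (2 ^ (d - 1)) ≠ ∞ := ENNReal.ofReal_ne_top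
  refine ⟨(ω / (ω ^ β * T)) ^ d / ENNReal.ofReal (2 ^ (d - 1)),
    (ENNReal.div_pos (pow_ne_zero _ (ENNReal.div_pos hω0 hC).ne') h2).ne',
    fun {h x y z₀} hh hx hy hz₀ hadm => ?_⟩
  set S := ∫⁻ θ, h θ ^ d ∂μ.toSphere
  rw [ENNReal.div_le_iff' (by positivity) h2]
  calc (ω / (ω ^ β * T)) ^ d ≤ ((ENNReal.ofReal (2 ^ (d - 1)) * S) ^ (1 / d : ℝ)) ^ d := by
        gcongr
        exact ENNReal.div_le_of_le_mul
          (measure_ball_le_of_one_le_lintegral_brokenLine hh hx hy hz₀ hadm)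
    _ = ENNReal.ofReal (2 ^ (d - 1)) * S := by
        rw [← ENNReal.rpow_natCast, ← ENNReal.rpow_mul, one_div_mul_cancel hdR.ne',
          ENNReal.rpow_one]

end SphereEstimate

/-- A metric form of admissibility of the density `ρ` for the paths from `A` to `B`: only Lipschitz
paths, parametrised by `[-1, 1]`, are tested, and the Lipschitz constant takes the place of the
speed in the line integral. -/
def LipschitzAdmissible {X : Type*} [PseudoEMetricSpace X] [MeasurableSpace X] (ρ : X → ℝ≥0∞)
    (A B : Set X) : Prop :=
  Measurable ρ ∧ ∀ (γ : ℝ → X) (K : ℝ≥0), LipschitzOnWith K γ (Icc (-1) 1) →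
    γ (-1) ∈ A → γ 1 ∈ B → 1 ≤ K * ∫⁻ τ in Icc (-1) 1, ρ (γ τ)

namespace LipschitzAdmissible

variable {X : Type*} [PseudoEMetricSpace X] [MeasurableSpace X] {ρ ρ' : X → ℝ≥0∞}
  {A A' B B' : Set X}

theorem mono (h : LipschitzAdmissible ρ A B) (hA : A' ⊆ A) (hB : B' ⊆ B) :
    LipschitzAdmissible ρ A' B' :=
  ⟨h.1, fun γ K hγ h₁ h₂ => h.2 γ K hγ (hA h₁) (hB h₂)⟩

theorem union (h : LipschitzAdmissible ρ A B) (h' : LipschitzAdmissible ρ' A' B) :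
    LipschitzAdmissible (ρ ⊔ ρ') (A ∪ A') B := by
  refine ⟨h.1.sup h'.1, fun γ K hγ h₁ h₂ => ?_⟩
  rcases h₁ with h₁ | h₁
  · grw [h.2 γ K hγ h₁ h₂]
    gcongr
    exact le_sup_left
  · grw [h'.2 γ K hγ h₁ h₂]
    gcongr
    exact le_sup_right

end LipschitzAdmissible

section RingEstimate

variable {V : Type*} [NormedAddCommGroup V] [InnerProductSpace ℝ V]

theorem exists_norm_eq_one_inner_nonneg (hV : 2 ≤ finrank ℝ V) (x y : V) :
    ∃ z : V, ‖z‖ = 1 ∧ 0 ≤ ⟪x, z⟫ ∧ 0 ≤ ⟪y, z⟫ := by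
  have : FiniteDimensional ℝ V := .of_finrank_pos (by lia)
  have hne : (ℝ ∙ (x - y))ᗮ ≠ ⊥ := by
    intro h
    have hsum := (ℝ ∙ (x - y)).finrank_add_finrank_orthogonal
    have hle : finrank ℝ (ℝ ∙ (x - y)) ≤ 1 :=
      (finrank_span_le_card (R := ℝ) {x - y}).trans_eq (by simp)
    rw [h, finrank_bot] at hsum
    lia
  obtain ⟨z, hz0, hxz, hyz⟩ : ∃ z : V, z ≠ 0 ∧ 0 ≤ ⟪x, z⟫ ∧ 0 ≤ ⟪y, z⟫ := by
    obtain ⟨z, hz, hz0⟩ := Submodule.exists_mem_ne_zero_of_ne_bot hne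
    have hxy : ⟪x, z⟫ = ⟪y, z⟫ := by
      simpa [inner_sub_left, sub_eq_zero] using
        Submodule.mem_orthogonal_singleton_iff_inner_right.1 hz
    rcases le_total 0 ⟪x, z⟫ with h | h
    · exact ⟨z, hz0, h, hxy ▸ h⟩
    · refine ⟨-z, neg_ne_zero.2 hz0, ?_, ?_⟩ <;> rw [inner_neg_right]
      exacts [neg_nonneg.2 h, neg_nonneg.2 (hxy ▸ h)]
  refine ⟨normalize z, norm_normalize_eq_one_iff.2 hz0, ?_, ?_⟩ <;>
    rw [NormedSpace.normalize, inner_smul_right] <;> positivity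

theorem norm_normalize_sub_eq_one {x x₀ : V} {r : ℝ} (hr : 0 < r) (hx : x ∈ sphere x₀ r) :
    ‖normalize (x - x₀)‖ = 1 := by
  rw [mem_sphere_iff_norm] at hx
  exact norm_normalize_eq_one_iff.2 (norm_pos_iff.1 (hx ▸ hr))

theorem add_smul_normalize_sub {x x₀ : V} {r : ℝ} (hx : x ∈ sphere x₀ r) :
    x₀ + r • normalize (x - x₀) = x := by
  rw [← mem_sphere_iff_norm.1 hx, norm_smul_normalize, add_sub_cancel]

theorem third_le_norm_brokenLine {x y z z₀ : V} (hx : ‖x‖ = 1) (hy : ‖y‖ = 1)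
    (hz₀ : ‖z₀‖ = 1) (hxz : 0 ≤ ⟪x, z₀⟫) (hyz : 0 ≤ ⟪y, z₀⟫) (hz : z ∈ ball z₀ (1 / 4))
    {τ : ℝ} (hτ : τ ∈ Icc (-1 : ℝ) 1) : 1 / 3 ≤ ‖brokenLine x z y τ‖ := by
  have ht : 0 ≤ 1 - |τ| := by rw [sub_nonneg, abs_le]; exact hτ
  set q := max (-τ) 0 • x + max τ 0 • y with hqdef
  obtain ⟨hq, hqz⟩ : ‖q‖ = |τ| ∧ 0 ≤ ⟪q, z₀⟫ := by
    rcases le_total τ 0 with h | h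
    · simp [hqdef, h, norm_smul, hx, inner_smul_left, mul_nonpos_of_nonpos_of_nonneg h hxz]
    · simp [hqdef, h, norm_smul, hy, inner_smul_left, mul_nonneg, hyz]
  have hsq : 1 / 2 ≤ ‖q + (1 - |τ|) • z₀‖ ^ 2 := by
    rw [norm_add_sq_real, norm_smul, hq, hz₀, inner_smul_right, Real.norm_of_nonneg ht]
    nlinarith [sq_nonneg (2 * |τ| - 1), mul_nonneg ht hqz]
  have hnorm : 7 / 10 ≤ ‖q + (1 - |τ|) • z₀‖ := by
    by_contra! h
    nlinarith [norm_nonneg (q + (1 - |τ|) • z₀)]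
  have hdist : dist (q + (1 - |τ|) • z) (q + (1 - |τ|) • z₀) ≤ 1 / 4 := by
    rw [dist_add_left, dist_smul₀, Real.norm_of_nonneg ht]
    nlinarith [dist_nonneg (x := z) (y := z₀), mem_ball.1 hz, abs_nonneg τ]
  change 1 / 3 ≤ ‖q + (1 - |τ|) • z‖
  rw [dist_comm, dist_eq_norm] at hdist
  linarith [norm_le_norm_add_norm_sub' (q + (1 - |τ|) • z₀) (q + (1 - |τ|) • z)]

theorem exists_lipschitzOnWith_normalize_brokenLine (hV : 2 ≤ finrank ℝ V) {x y : V}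
    (hx : ‖x‖ = 1) (hy : ‖y‖ = 1) :
    ∃ z₀ : V, ‖z₀‖ = 1 ∧ ∀ z ∈ ball z₀ (1 / 4),
      LipschitzOnWith 24 (fun τ => normalize (brokenLine x z y τ)) (Icc (-1) 1) := by
  obtain ⟨z₀, hz₀, hxz, hyz⟩ := exists_norm_eq_one_inner_nonneg hV x y
  refine ⟨z₀, hz₀, fun z hz => LipschitzOnWith.of_dist_le_mul fun τ hτ τ' hτ' => ?_⟩
  have hz2 : ‖z‖ ≤ 2 := by
    linarith [norm_le_norm_add_norm_sub' z z₀, mem_ball_iff_norm.1 hz]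
  have hlow {τ : ℝ} (hτ : τ ∈ Icc (-1) 1) := third_le_norm_brokenLine hx hy hz₀ hxz hyz hz hτ
  have hne : brokenLine x z y τ' ≠ 0 := norm_pos_iff.1 (by linarith [hlow hτ'])
  have hlip := (lipschitzWith_brokenLine hx.le hz2 hy.le).dist_le_mul τ τ'
  have hnormalize := norm_mul_norm_normalize_sub_normalize_le (u := brokenLine x z y τ) hne
  rw [← dist_eq_norm, ← dist_eq_norm] at hnormalize
  push_cast at hlip ⊢
  nlinarith [hlow hτ, dist_nonneg (x := normalize (brokenLine x z y τ))
    (y := normalize (brokenLine x z y τ'))]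

variable [MeasurableSpace V] [BorelSpace V] {μ : Measure V} [μ.IsAddHaarMeasure]
  [FiniteDimensional ℝ V]

theorem exists_le_lintegral_toSphere_pow_of_lipschitzAdmissible (hV : 2 ≤ finrank ℝ V) :
    ∃ c : ℝ≥0∞, c ≠ 0 ∧ ∀ {ρ : V → ℝ≥0∞} {x₀ x y : V} {r : ℝ}, 0 < r → x ∈ sphere x₀ r →
      y ∈ sphere x₀ r → LipschitzAdmissible ρ {x} {y} →
      c ≤ ENNReal.ofReal (r ^ finrank ℝ V) *
        ∫⁻ θ, ρ (x₀ + r • (θ : V)) ^ finrank ℝ V ∂μ.toSphere := by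
  have : Nontrivial V := nontrivial_of_finrank_pos (R := ℝ) (by lia)
  obtain ⟨c, hc, hle⟩ := exists_le_lintegral_toSphere_pow (μ := μ)
  refine ⟨c / 24 ^ finrank ℝ V, (ENNReal.div_pos hc (by finiteness)).ne',
    fun {ρ x₀ x y r} hr hx hy hρ => ?_⟩
  have hx1 := norm_normalize_sub_eq_one hr hx
  have hy1 := norm_normalize_sub_eq_one hr hy
  obtain ⟨z₀, hz₀, hlip⟩ := exists_lipschitzOnWith_normalize_brokenLine hV hx1 hy1
  have hK : ENNReal.ofReal r * 24 ≠ ∞ := by finiteness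
  have hρm := hρ.1
  have hbound := hle (h := fun w => ENNReal.ofReal r * 24 * ρ (x₀ + r • w)) (by fun_prop) hx1.le
    hy1.le hz₀.le fun z hz => by
      rw [lintegral_const_mul' _ _ hK]
      refine hρ.2 (fun τ => x₀ + r • normalize (brokenLine _ z _ τ)) (r.toNNReal * 24)
        (LipschitzOnWith.of_dist_le_mul fun τ hτ τ' hτ' => ?_) ?_ ?_
      · rw [dist_add_left, dist_smul₀, Real.norm_of_nonneg hr.le, NNReal.coe_mul, mul_assoc,
          Real.coe_toNNReal _ hr.le]
        gcongr
        exact (hlip z hz).dist_le_mul τ hτ τ' hτ'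
      · rw [mem_singleton_iff, brokenLine_neg_one, normalize_eq_self_of_norm_eq_one hx1,
          add_smul_normalize_sub hx]
      · rw [mem_singleton_iff, brokenLine_one, normalize_eq_self_of_norm_eq_one hy1,
          add_smul_normalize_sub hy]
  refine ENNReal.div_le_of_le_mul (hbound.trans_eq ?_)
  simp only [mul_pow]
  rw [lintegral_const_mul' _ _ (by finiteness), ENNReal.ofReal_pow hr.le]
  ring

theorem lintegral_Ioo_ofReal_inv {a b : ℝ} (ha : 0 < a) (hab : a ≤ b) :
    ∫⁻ r in Ioo a b, ENNReal.ofReal r⁻¹ = ENNReal.ofReal (Real.log (b / a)) := by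
  have hint : IntervalIntegrable (fun r : ℝ => r⁻¹) volume a b :=
    intervalIntegrable_inv_iff.2
      (Or.inr (notMem_uIcc_of_lt ha (ha.trans_le hab)))
  rw [setLIntegral_congr Ioo_ae_eq_Ioc, ← integral_inv_of_pos ha (ha.trans_le hab),
    intervalIntegral.integral_of_le hab, ofReal_integral_eq_lintegral_ofReal hint.1]
  filter_upwards [ae_restrict_mem measurableSet_Ioc] with r hr
  exact inv_nonneg.2 (ha.trans hr.1).le

variable (μ) in
theorem exists_mul_log_le_lintegral_pow (hV : 2 ≤ finrank ℝ V) :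
    ∃ c : ℝ≥0∞, c ≠ 0 ∧ ∀ {ρ : V → ℝ≥0∞} {A B : Set V} {x₀ : V} {a b : ℝ},
      LipschitzAdmissible ρ A B → 0 < a → a ≤ b →
      (∀ r ∈ Ioo a b, (sphere x₀ r ∩ A).Nonempty ∧ (sphere x₀ r ∩ B).Nonempty) →
      c * ENNReal.ofReal (Real.log (b / a)) ≤ ∫⁻ x, ρ x ^ finrank ℝ V ∂μ := by
  have : Nontrivial V := nontrivial_of_finrank_pos (R := ℝ) (by lia)
  obtain ⟨c, hc, hle⟩ := exists_le_lintegral_toSphere_pow_of_lipschitzAdmissible (μ := μ) hV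
  refine ⟨c, hc, fun {ρ A B x₀ a b} hρ ha hab hmeet => ?_⟩
  set d := finrank ℝ V
  have hρm := hρ.1
  calc c * ENNReal.ofReal (Real.log (b / a)) = ∫⁻ r in Ioo a b, c * ENNReal.ofReal r⁻¹ := by
        rw [lintegral_const_mul _ (by fun_prop), lintegral_Ioo_ofReal_inv ha hab]
    _ ≤ ∫⁻ r in Ioo a b, ENNReal.ofReal (r ^ (d - 1)) *
          ∫⁻ θ, ρ (x₀ + r • (θ : V)) ^ d ∂μ.toSphere := by
        refine setLIntegral_mono' measurableSet_Ioo fun r hr => ?_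
        have hr0 : 0 < r := ha.trans hr.1
        obtain ⟨⟨x, hx, hxA⟩, y, hy, hyB⟩ := hmeet r hr
        grw [hle hr0 hx hy (hρ.mono (singleton_subset_iff.2 hxA) (singleton_subset_iff.2 hyB)),
          mul_right_comm, ← ENNReal.ofReal_mul (by positivity), ← div_eq_mul_inv,
          ← pow_sub_one_mul (n := d) (by lia) r, mul_div_cancel_right₀ _ hr0.ne']
    _ ≤ ∫⁻ r in Ioi (0 : ℝ), ENNReal.ofReal (r ^ (d - 1)) *
          ∫⁻ θ, ρ (x₀ + r • (θ : V)) ^ d ∂μ.toSphere :=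
        lintegral_mono_set fun r hr => ha.trans hr.1
    _ = ∫⁻ x, ρ x ^ d ∂μ := (lintegral_polar (hρm.pow_const d) x₀).symm

variable (μ) in
theorem exists_ratio_lt_lintegral_pow (hV : 2 ≤ finrank ℝ V) {M : ℝ≥0∞} (hM : M ≠ ∞) :
    ∃ L > 1, ∀ {ρ : V → ℝ≥0∞} {A B : Set V} {x₀ : V} {a : ℝ}, LipschitzAdmissible ρ A B → 0 < a →
      (∀ r ∈ Ioo a (L * a), (sphere x₀ r ∩ A).Nonempty ∧ (sphere x₀ r ∩ B).Nonempty) →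
      M < ∫⁻ x, ρ x ^ finrank ℝ V ∂μ := by
  obtain ⟨c, hc, hle⟩ := exists_mul_log_le_lintegral_pow μ hV
  set t := (M / c).toReal + 1
  have ht0 : 0 < t := by positivity
  refine ⟨Real.exp t, Real.one_lt_exp_iff.2 ht0, fun {ρ A B x₀ a} hρ ha hmeet => ?_⟩
  have h := hle hρ ha (le_mul_of_one_le_left ha.le (Real.one_le_exp ht0.le)) hmeet
  rw [mul_div_cancel_right₀ _ ha.ne', Real.log_exp] at h
  refine lt_of_lt_of_le ?_ h
  rw [mul_comm, ← ENNReal.div_lt_iff (Or.inl hc) (Or.inr hM),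
    ← ENNReal.ofReal_toReal (ENNReal.div_ne_top hM hc)]
  exact (ENNReal.ofReal_lt_ofReal_iff ht0).2 (lt_add_one _)

end RingEstimate

section LineIntegral

variable {X : Type*} [PseudoEMetricSpace X]

theorem eVariationOn_Icc_le_of_lipschitzOnWith {γ : ℝ → X} {K : ℝ≥0} {a b : ℝ}
    (hγ : LipschitzOnWith K γ (Icc a b)) :
    eVariationOn γ (Icc a b) ≤ K * ENNReal.ofReal (b - a) := by
  have h := hγ.comp_eVariationOn_le (g := id) (mapsTo_id _)
  rwa [Function.comp_id, eVariationOn_id_Icc] at h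

theorem lipschitzOnWith_variationOnFromTo {γ : ℝ → X} {K : ℝ≥0} {s : Set ℝ} [s.OrdConnected]
    (hγ : LipschitzOnWith K γ s) {a : ℝ} (ha : a ∈ s) :
    LipschitzOnWith K (variationOnFromTo γ s a) s := by
  have hbv : LocallyBoundedVariationOn γ s := hγ.locallyBoundedVariationOn
  refine LipschitzOnWith.of_le_add_mul K fun t ht u hu => ?_
  rcases le_total t u with h | h
  · grw [variationOnFromTo.monotoneOn hbv ha ht hu h]
    exact le_add_of_nonneg_right (by positivity)
  · rw [← variationOnFromTo.add hbv ha hu ht, variationOnFromTo.eq_of_le _ _ h, Real.dist_eq,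
      abs_of_nonneg (sub_nonneg.2 h), inter_eq_self_of_subset_right (OrdConnected.out ‹_› hu ht)]
    gcongr
    refine ENNReal.toReal_le_of_le_ofReal (by have := sub_nonneg.2 h; positivity) ?_
    rw [ENNReal.ofReal_mul K.coe_nonneg, ENNReal.ofReal_coe_nnreal]
    exact eVariationOn_Icc_le_of_lipschitzOnWith (hγ.mono (OrdConnected.out ‹_› hu ht))

theorem restrict_Icc_le_smul_map {V : ℝ → ℝ} {K : ℝ≥0} {a b : ℝ} (hab : a ≤ b)
    (hV : LipschitzOnWith K V (Icc a b)) :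
    volume.restrict (Icc (V a) (V b)) ≤ (K : ℝ≥0∞) • (volume.restrict (Icc a b)).map V := by
  have hVm : AEMeasurable V (volume.restrict (Icc a b)) :=
    hV.continuousOn.aemeasurable measurableSet_Icc
  refine Measure.le_iff.2 fun S hS => ?_
  rw [Measure.restrict_apply hS, Measure.smul_apply, smul_eq_mul,
    Measure.map_apply_of_aemeasurable hVm hS, Measure.restrict_apply' measurableSet_Icc]
  have hsub : S ∩ Icc (V a) (V b) ⊆ V '' (V ⁻¹' S ∩ Icc a b) := by
    rintro s ⟨hsS, hs⟩
    obtain ⟨t, ht, rfl⟩ := intermediate_value_Icc hab hV.continuousOn hs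
    exact ⟨t, ⟨hsS, ht⟩, rfl⟩
  have himage := (hV.mono (inter_subset_right (s := V ⁻¹' S))).hausdorffMeasure_image_le zero_le_one
  rw [hausdorffMeasure_real, ENNReal.rpow_one] at himage
  exact (measure_mono hsub).trans himage

theorem ClosedPath.length_ne_top {n : ℕ} {γ : ClosedPath n} {K : ℝ≥0}
    (hγ : LipschitzOnWith K γ.toFun (Icc γ.a γ.b)) : γ.length ≠ ∞ :=
  ne_top_of_le_ne_top (by finiteness) (eVariationOn_Icc_le_of_lipschitzOnWith hγ)

theorem ClosedPath.lineIntegral_le {n : ℕ} {γ : ClosedPath n} {K : ℝ≥0}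
    (hγ : LipschitzOnWith K γ.toFun (Icc γ.a γ.b)) (ρ : Eu n → ℝ≥0∞) :
    γ.lineIntegral ρ ≤ K * ∫⁻ t in Icc γ.a γ.b, ρ (γ.toFun t) := by
  set I := Icc γ.a γ.b
  have haI : γ.a ∈ I := left_mem_Icc.2 γ.le
  set V := variationOnFromTo γ.toFun I γ.a with hV
  have hlength : Icc 0 γ.length.toReal = Icc (V γ.a) (V γ.b) := by
    rw [hV, variationOnFromTo.self, variationOnFromTo.eq_of_le _ _ γ.le, inter_self]
    rfl
  calc γ.lineIntegral ρ
      ≤ ∫⁻ s, ρ (naturalParameterization γ.toFun I γ.a s)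
          ∂((K : ℝ≥0∞) • (volume.restrict I).map V) := by
        rw [ClosedPath.lineIntegral, hlength]
        exact lintegral_mono'
          (restrict_Icc_le_smul_map γ.le (lipschitzOnWith_variationOnFromTo hγ haI)) le_rfl
    _ ≤ K * ∫⁻ t in I, ρ (naturalParameterization γ.toFun I γ.a (V t)) := by
        rw [lintegral_smul_measure, smul_eq_mul]
        exact mul_le_mul_right
          (lintegral_map_le (fun s => ρ (naturalParameterization γ.toFun I γ.a s)) V) _
    _ = K * ∫⁻ t in I, ρ (γ.toFun t) := by
        congr 1
        refine setLIntegral_congr_fun measurableSet_Icc fun t ht => ?_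
        rw [edist_eq_zero.1 (edist_naturalParameterization_eq_zero hγ.locallyBoundedVariationOn
          haI ht)]

end LineIntegral

section ClosedDiscreteMaps

variable {n : ℕ} {D : Set (Eu n)} {f : Eu n → Eu n}

namespace OpenDiscreteClosed

theorem frequently_ne [Nontrivial (Eu n)] (hf : OpenDiscreteClosed D f) {x : Eu n} (hx : D ∈ 𝓝 x)
    (y : Eu n) : ∃ᶠ x' in 𝓝 x, f x' ≠ y := by
  by_contra! h
  have hfiber : D ∩ f ⁻¹' {y} ∈ 𝓝 x := inter_mem hx h
  have hpure := isDiscrete_iff_nhdsWithin.1 (hf.isDiscrete_fiber y) x (mem_of_mem_nhds hfiber)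
  rw [nhdsWithin_eq_nhds.2 hfiber] at hpure
  exact not_isOpen_singleton x (isOpen_singleton_iff_nhds_eq_pure x |>.2 hpure)

theorem notMem_image_of_tendsto [Nontrivial (Eu n)] (hf : OpenDiscreteClosed D f) (hD : IsOpen D)
    {x : ℕ → Eu n} {p y : Eu n} (hx : ∀ k, x k ∈ D) (hxp : Tendsto x atTop (𝓝 p)) (hp : p ∉ D)
    (hfx : Tendsto (fun k => f (x k)) atTop (𝓝 y)) : y ∉ f '' D := by
  intro hy
  have hperturb (k : ℕ) : ∃ x' ∈ D, dist x' (x k) < 1 / ((k : ℝ) + 1) ∧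
      dist (f x') (f (x k)) < 1 / ((k : ℝ) + 1) ∧ f x' ≠ y := by
    have hk : (0 : ℝ) < 1 / ((k : ℝ) + 1) := by positivity
    have hDk := hD.mem_nhds (hx k)
    have hc : ContinuousAt f (x k) := hf.continuousOn.continuousAt hDk
    obtain ⟨x', hne, hx'D, hx', hfx'⟩ := ((hf.frequently_ne hDk y).and_eventually
      (inter_mem hDk <| inter_mem (ball_mem_nhds _ hk) (hc (ball_mem_nhds _ hk)))).exists
    exact ⟨x', hx'D, hx', hfx', hne⟩
  choose x' hx'D hx'x hfx' hne using hperturb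
  have hlim : Tendsto (fun k : ℕ => 1 / ((k : ℝ) + 1)) atTop (𝓝 0) :=
    tendsto_one_div_add_atTop_nhds_zero_nat
  have hx'p : Tendsto x' atTop (𝓝 p) := (tendsto_iff_of_dist
    (squeeze_zero (fun _ => dist_nonneg) (fun k => (hx'x k).le) hlim)).2 hxp
  have hfy : Tendsto (fun k => f (x' k)) atTop (𝓝 y) := (tendsto_iff_of_dist
    (squeeze_zero (fun _ => dist_nonneg) (fun k => (hfx' k).le) hlim)).2 hfx
  obtain ⟨C, hC, hCeq⟩ := hf.isClosed_image _ hx'p.isCompact_insert_range.isClosed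
  have hyC : y ∈ C := hC.mem_of_tendsto hfy <| .of_forall fun k =>
    (hCeq.subset ⟨x' k, ⟨hx'D k, Or.inr ⟨k, rfl⟩⟩, rfl⟩).2
  obtain ⟨w, ⟨hwD, rfl | ⟨k, rfl⟩⟩, hw⟩ := hCeq.superset ⟨hy, hyC⟩
  exacts [hp hwD, hne k hw]

theorem isClosed_inter_preimage [Nontrivial (Eu n)] (hf : OpenDiscreteClosed D f) (hD : IsOpen D)
    {F : Set (Eu n)} (hF : IsCompact F) (hFD : F ⊆ f '' D) : IsClosed (D ∩ f ⁻¹' F) := by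
  refine isClosed_of_closure_subset fun p hp => ?_
  obtain ⟨x, hx, hxp⟩ := mem_closure_iff_seq_limit.1 hp
  obtain ⟨y, hyF, φ, hφ, hlim⟩ := hF.tendsto_subseq fun k => (hx k).2
  have hxφ : Tendsto (x ∘ φ) atTop (𝓝 p) := hxp.comp hφ.tendsto_atTop
  have hpD : p ∈ D := by
    by_contra h
    exact hf.notMem_image_of_tendsto hD (fun k => (hx (φ k)).1) hxφ h hlim (hFD hyF)
  have hfp := (hf.continuousOn.continuousAt (hD.mem_nhds hpD)).tendsto.comp hxφ
  exact ⟨hpD, by rwa [mem_preimage, tendsto_nhds_unique hfp hlim]⟩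

theorem exists_notMem_of_path [Nontrivial (Eu n)] (hf : OpenDiscreteClosed D f) (hD : IsOpen D)
    {γ : ℝ → Eu n} {a b : ℝ} (hab : a ≤ b) (hγ : ContinuousOn γ (Icc a b)) (ha : γ a ∈ D)
    (hb : γ b ∉ D) {F : Set (Eu n)} (hF : IsCompact F) (hFD : F ⊆ f '' D) :
    ∃ T ∈ Icc a b, (∀ t ∈ Icc a T, γ t ∈ D) ∧ f (γ T) ∉ F := by
  set S := Icc a b ∩ γ ⁻¹' Dᶜ
  have hS : IsCompact S := isCompact_Icc.of_isClosed_subset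
    (hγ.preimage_isClosed_of_isClosed isClosed_Icc hD.isClosed_compl) inter_subset_left
  have hT := hS.sInf_mem ⟨b, right_mem_Icc.2 hab, hb⟩
  set T := sInf S
  have hlt : MapsTo γ (Ico a T) D := fun t ht => by
    by_contra h
    exact (csInf_le hS.bddBelow ⟨⟨ht.1, ht.2.le.trans hT.1.2⟩, h⟩).not_gt ht.2
  have haT : a ≠ T := fun h => hT.2 (h ▸ ha)
  by_contra! hcon
  have hmaps : MapsTo γ (Ico a T) (D ∩ f ⁻¹' F) := fun t ht => ⟨hlt ht,
    hcon t ⟨ht.1, ht.2.le.trans hT.1.2⟩ fun s hs => hlt ⟨hs.1, hs.2.trans_lt ht.2⟩⟩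
  have hclosure := hmaps.closure_of_continuousOn
    (by rw [closure_Ico haT]; exact hγ.mono (Icc_subset_Icc_right hT.1.2))
  rw [closure_Ico haT, (hf.isClosed_inter_preimage hD hF hFD).closure_eq] at hclosure
  exact hT.2 (hclosure (right_mem_Icc.2 hT.1.1)).1

end OpenDiscreteClosed

theorem exists_first_hit {φ : ℝ → ℝ} {a b r : ℝ} (hab : a ≤ b) (hφ : ContinuousOn φ (Icc a b))
    (ha : φ a ≤ r) (hb : r ≤ φ b) : ∃ t ∈ Icc a b, φ t = r ∧ ∀ s ∈ Ico a t, φ s < r := by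
  set S := Icc a b ∩ φ ⁻¹' Ici r
  have hS : IsCompact S := isCompact_Icc.of_isClosed_subset
    (hφ.preimage_isClosed_of_isClosed isClosed_Icc isClosed_Ici) inter_subset_left
  have ht := hS.sInf_mem ⟨b, right_mem_Icc.2 hab, hb⟩
  set t := sInf S
  have hle {s : ℝ} (hs : s ∈ Icc a t) (hr : r ≤ φ s) : t ≤ s :=
    csInf_le hS.bddBelow ⟨⟨hs.1, hs.2.trans ht.1.2⟩, hr⟩
  refine ⟨t, ht.1, ?_, fun s hs => not_le.1 fun h => (hle ⟨hs.1, hs.2.le⟩ h).not_gt hs.2⟩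
  obtain ⟨s, hs, rfl⟩ :=
    intermediate_value_Icc ht.1.1 (hφ.mono (Icc_subset_Icc_right ht.1.2)) ⟨ha, ht.2⟩
  rw [hs.2.antisymm (hle hs le_rfl)]

theorem exists_last_hit {φ : ℝ → ℝ} {a b r : ℝ} (hab : a ≤ b) (hφ : ContinuousOn φ (Icc a b))
    (ha : φ a ≤ r) (hb : r ≤ φ b) : ∃ t ∈ Icc a b, φ t = r ∧ ∀ s ∈ Ioc t b, r < φ s := by
  have hneg : ContinuousOn (fun t => -φ (-t)) (Icc (-b) (-a)) :=
    (hφ.comp continuousOn_neg fun t ht => ⟨le_neg.1 ht.2, neg_le.1 ht.1⟩).neg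
  obtain ⟨t, ht, htr, hlt⟩ := exists_first_hit (r := -r) (neg_le_neg hab) hneg
    (by simpa using hb) (by simpa using ha)
  refine ⟨-t, ⟨le_neg.1 ht.2, neg_le.1 ht.1⟩, neg_injective htr, fun s hs => ?_⟩
  simpa using hlt (-s) ⟨neg_le_neg hs.2, neg_lt.1 hs.1⟩

theorem exists_crossing {φ : ℝ → ℝ} {a b r₁ r₂ : ℝ} (hab : a ≤ b) (hφ : ContinuousOn φ (Icc a b))
    (h₁₂ : r₁ ≤ r₂) (ha : φ a ≤ r₁) (hb : r₂ ≤ φ b) :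
    ∃ a' b', a ≤ a' ∧ a' ≤ b' ∧ b' ≤ b ∧ φ a' = r₁ ∧ φ b' = r₂ ∧
      ∀ t ∈ Ioo a' b', r₁ < φ t ∧ φ t < r₂ := by
  obtain ⟨b', hb', hφb', hlt⟩ := exists_first_hit hab hφ (ha.trans h₁₂) hb
  obtain ⟨a', ha', hφa', hgt⟩ := exists_last_hit hb'.1 (hφ.mono (Icc_subset_Icc_right hb'.2)) ha
    (h₁₂.trans_eq hφb'.symm)
  exact ⟨a', b', ha'.1, ha'.2, hb'.2, hφa', hφb', fun t ht =>
    ⟨hgt t ⟨ht.1, ht.2.le⟩, hlt t ⟨ha'.1.trans ht.1.le, ht.2⟩⟩⟩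

theorem Admissible.lipschitzAdmissible [Nontrivial (Eu n)] (hD : IsOpen D)
    (hf : OpenDiscreteClosed D f) {y₀ : Eu n} {r₁ r₂ : ℝ} (h₁₂ : r₁ ≤ r₂)
    (hball : closedBall y₀ r₂ ⊆ f '' D) {ρ : Eu n → ℝ≥0∞}
    (hρ : Admissible (ringFamily D f y₀ r₁ r₂) ρ) :
    LipschitzAdmissible ρ (D ∩ f ⁻¹' closedBall y₀ r₁) Dᶜ := by
  refine ⟨hρ.1, fun γ K hγ ha hb => ?_⟩
  obtain ⟨T, hT, hTD, hTF⟩ := hf.exists_notMem_of_path hD (by norm_num) hγ.continuousOn ha.1 hb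
    (isCompact_closedBall y₀ r₂) hball
  have hfγ : ContinuousOn (fun t => f (γ t)) (Icc (-1) T) :=
    hf.continuousOn.comp (hγ.continuousOn.mono (Icc_subset_Icc_right hT.2)) hTD
  have hcont : ContinuousOn (fun t => dist (f (γ t)) y₀) (Icc (-1) T) :=
    (continuous_id.dist continuous_const).comp_continuousOn hfγ
  obtain ⟨a', b', haa', ha'b', hb'T, hra, hrb, hmid⟩ := exists_crossing hT.1 hcont h₁₂ ha.2
    (not_le.1 hTF).le
  have hsub : Icc a' b' ⊆ Icc (-1) T := Icc_subset_Icc haa' hb'T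
  have hsub1 : Icc a' b' ⊆ Icc (-1) 1 := hsub.trans (Icc_subset_Icc_right hT.2)
  have hlip : LipschitzOnWith K γ (Icc a' b') := hγ.mono hsub1
  let β : ClosedPath n := ⟨a', b', ha'b', γ, hlip.continuousOn⟩
  have hβ : β ∈ ringFamily D f y₀ r₁ r₂ := ⟨fun t ht => hTD t (hsub ht), hra, hrb, hmid⟩
  calc 1 ≤ β.lineIntegral ρ := hρ.2 β hβ (ClosedPath.length_ne_top (γ := β) hlip)
    _ ≤ K * ∫⁻ t in Icc a' b', ρ (γ t) := ClosedPath.lineIntegral_le (γ := β) hlip ρ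
    _ ≤ K * ∫⁻ t in Icc (-1) 1, ρ (γ t) := by grw [lintegral_mono_set hsub1]

end ClosedDiscreteMaps

section UniformDensity

variable {n : ℕ} [NeZero n] {D D₀ : Set (Eu n)} {Q : Eu n → ℝ≥0∞}

theorem lt_outerRadius {G : Set (Eu n)} {y₀ : Eu n} {r R : ℝ} (hr : 0 ≤ r) (hrR : r < R)
    (hG : closedBall y₀ R ⊆ G) : ENNReal.ofReal r < outerRadius G y₀ := by
  obtain ⟨w, hw⟩ := (NormedSpace.sphere_nonempty (x := y₀)).2 (hr.trans hrR.le)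
  calc ENNReal.ofReal r < ENNReal.ofReal R :=
        (ENNReal.ofReal_lt_ofReal_iff (hr.trans_lt hrR)).2 hrR
    _ = edist w y₀ := by rw [edist_dist, mem_sphere.1 hw]
    _ ≤ outerRadius G y₀ :=
        le_iSup₂ (f := fun y (_ : y ∈ G) => edist y y₀) w (hG (sphere_subset_closedBall hw))

theorem exists_lipschitzAdmissible_closedBall (hQ : AEMeasurable Q)
    (hQint : IntegrableOverSpheres D₀ Q) (hD : IsOpen D) {y₀ : Eu n} {r R : ℝ} (hr : 0 < r)
    (hrR : r < R) (hball : closedBall y₀ R ⊆ D₀) :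
    ∃ M ≠ ∞, ∀ f : Eu n → Eu n, OpenDiscreteClosed D f → InversePoletsky D f Q y₀ →
      closedBall y₀ R ⊆ f '' D →
      ∃ ρ, LipschitzAdmissible ρ (D ∩ f ⁻¹' closedBall y₀ r) Dᶜ ∧ ∫⁻ x, ρ x ^ n ≤ M := by
  obtain ⟨s, hrs, hsR⟩ := exists_between hrR
  have hs : 0 ≤ s := (hr.trans hrs).le
  have hy₀ : y₀ ∈ D₀ := hball (mem_closedBall_self (hr.trans hrR).le)
  obtain ⟨E₁, hE₁, hE₁m, hE₁0, hfin⟩ :=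
    hQint y₀ (subset_closure hy₀) r s hr hrs (lt_outerRadius hs hsR hball)
  obtain ⟨η, hη, hη1, hηQ⟩ := exists_weight_lintegral_mul_lt_top hQ y₀ hr hE₁ hE₁m hE₁0.ne'
    (by simpa only [finrank_euclideanSpace_fin] using fun t ht => (hfin t ht).2) (NeZero.ne n)
  refine ⟨(∫⁻ y, Q y * η (dist y y₀) ^ n) + 1, by finiteness, fun f hf hPoletsky hcov => ?_⟩
  have hmod : modulus (ringFamily D f y₀ r s) < (∫⁻ y, Q y * η (dist y y₀) ^ n) + 1 := by
    grw [hPoletsky r s hr hrs (lt_outerRadius hs hsR hcov) η hη.aemeasurable hη1,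
      setLIntegral_le_lintegral]
    exact ENNReal.lt_add_right hηQ.ne one_ne_zero
  obtain ⟨ρ, hρ, hle⟩ : ∃ ρ, Admissible (ringFamily D f y₀ r s) ρ ∧
      ∫⁻ x, ρ x ^ n < (∫⁻ y, Q y * η (dist y y₀) ^ n) + 1 := by
    simpa only [modulus, iInf_lt_iff, exists_prop] using hmod
  exact ⟨ρ, hρ.lipschitzAdmissible hD hf hrs.le
    ((closedBall_subset_closedBall hsR.le).trans hcov), hle.le⟩

theorem lintegral_sup_pow_le {α : Type*} [MeasurableSpace α] {μ : Measure α} {ρ ρ' : α → ℝ≥0∞}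
    (hρ : Measurable ρ) (k : ℕ) :
    ∫⁻ x, (ρ ⊔ ρ') x ^ k ∂μ ≤ ∫⁻ x, ρ x ^ k ∂μ + ∫⁻ x, ρ' x ^ k ∂μ := by
  rw [← lintegral_add_left (hρ.pow_const k)]
  refine lintegral_mono fun x => ?_
  rcases le_total (ρ x) (ρ' x) with h | h
  · simp [h]
  · simp [h]

theorem exists_eventually_lipschitzAdmissible {ι : Type*} {l : Filter ι} (hQ : AEMeasurable Q)
    (hQint : IntegrableOverSpheres D₀ Q) (hD : IsOpen D) (hD₀ : IsOpen D₀) {E : Set (Eu n)}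
    (hE : IsCompact E) (hED₀ : E ⊆ D₀) {f : ι → Eu n → Eu n} (hf : ∀ m, OpenDiscreteClosed D (f m))
    (hPoletsky : ∀ m, ∀ y₀ ∈ D₀, InversePoletsky D (f m) Q y₀)
    (hcov : ∀ K ⊆ D₀, IsCompact K → ∀ᶠ m in l, K ⊆ f m '' D) :
    ∃ M ≠ ∞, ∀ᶠ m in l,
      ∃ ρ, LipschitzAdmissible ρ (D ∩ f m ⁻¹' E) Dᶜ ∧ ∫⁻ x, ρ x ^ n ≤ M := by
  refine hE.induction_on (p := fun S => ∃ M ≠ ∞, ∀ᶠ m in l,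
    ∃ ρ, LipschitzAdmissible ρ (D ∩ f m ⁻¹' S) Dᶜ ∧ ∫⁻ x, ρ x ^ n ≤ M) ?_ ?_ ?_ ?_
  · exact ⟨0, ENNReal.zero_ne_top, .of_forall fun m =>
      ⟨0, ⟨measurable_zero, fun γ K _ h => absurd h.2 (notMem_empty _)⟩, by simp [NeZero.ne n]⟩⟩
  · rintro S T hST ⟨M, hM, h⟩
    exact ⟨M, hM, h.mono fun m ⟨ρ, hρ, hle⟩ => ⟨ρ, hρ.mono (by gcongr) subset_rfl, hle⟩⟩
  · rintro S T ⟨M, hM, h⟩ ⟨M', hM', h'⟩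
    refine ⟨M + M', ENNReal.add_ne_top.2 ⟨hM, hM'⟩, (h.and h').mono ?_⟩
    rintro m ⟨⟨ρ, hρ, hle⟩, ρ', hρ', hle'⟩
    refine ⟨ρ ⊔ ρ', ?_, (lintegral_sup_pow_le hρ.1 n).trans (add_le_add hle hle')⟩
    rw [preimage_union, inter_union_distrib_left]
    exact hρ.union hρ'
  · intro y hy
    obtain ⟨R, hR, hball⟩ := nhds_basis_closedBall.mem_iff.1 (hD₀.mem_nhds (hED₀ hy))
    obtain ⟨M, hM, h⟩ :=
      exists_lipschitzAdmissible_closedBall hQ hQint hD (half_pos hR) (half_lt_self hR) hball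
    exact ⟨closedBall y (R / 2), mem_nhdsWithin_of_mem_nhds (closedBall_mem_nhds y (half_pos hR)),
      M, hM, (hcov _ hball (isCompact_closedBall y R)).mono fun m hm =>
        h (f m) (hf m) (hPoletsky m y (hED₀ hy)) hm⟩

end UniformDensity

section ChordalMetric

variable {n : ℕ}

/-- The point `(x, 1)` of the hyperplane `ℝⁿ × {1}` at distance `1` from the origin, on which the
stereographic projection is based. -/
def hyperplanePoint (x : Eu n) : WithLp 2 (Eu n × ℝ) := WithLp.toLp 2 (x, 1)

theorem norm_hyperplanePoint (x : Eu n) : ‖hyperplanePoint x‖ = √(1 + ‖x‖ ^ 2) := by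
  simp [hyperplanePoint, WithLp.prod_norm_eq_of_L2, add_comm]

theorem hyperplanePoint_ne_zero (x : Eu n) : hyperplanePoint x ≠ 0 := by
  rw [← norm_pos_iff, norm_hyperplanePoint]
  positivity

theorem isometry_hyperplanePoint : Isometry (hyperplanePoint (n := n)) :=
  .of_dist_eq fun x y => by simp [hyperplanePoint, WithLp.prod_dist_eq_of_L2]

/-- The inverse of the stereographic projection, onto the sphere with diameter from `0` to `(0, 1)`
in `ℝⁿ × ℝ`: the inversion in the unit sphere maps the hyperplane `ℝⁿ × {1}` to this sphere, and
`∞` corresponds to `0`. It turns the chordal metric into the Euclidean distance. -/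
def stereoInv : ExtEu n → WithLp 2 (Eu n × ℝ)
  | none => 0
  | some x => EuclideanGeometry.inversion 0 1 (hyperplanePoint x)

theorem dist_stereoInv_coe_zero (x : Eu n) :
    dist (stereoInv (x : ExtEu n)) 0 = 1 / √(1 + ‖x‖ ^ 2) := by
  refine (EuclideanGeometry.dist_inversion_center 0 (hyperplanePoint x) 1).trans ?_
  rw [dist_zero_right, norm_hyperplanePoint, one_pow]

theorem dist_stereoInv_coe_coe (x y : Eu n) : dist (stereoInv (x : ExtEu n)) (stereoInv y) =
    ‖x - y‖ / (√(1 + ‖x‖ ^ 2) * √(1 + ‖y‖ ^ 2)) := by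
  refine (EuclideanGeometry.dist_inversion_inversion (hyperplanePoint_ne_zero x)
    (hyperplanePoint_ne_zero y) 1).trans ?_
  rw [isometry_hyperplanePoint.dist_eq, dist_zero_right, dist_zero_right, norm_hyperplanePoint,
    norm_hyperplanePoint, dist_eq_norm]
  ring

theorem dist_stereoInv (p q : ExtEu n) : dist (stereoInv p) (stereoInv q) = chordal p q := by
  induction p using OnePoint.rec with
  | infty =>
    induction q using OnePoint.rec with
    | infty => exact dist_self _
    | coe y => exact (dist_comm _ _).trans (dist_stereoInv_coe_zero y)
  | coe x =>
    induction q using OnePoint.rec with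
    | infty => exact dist_stereoInv_coe_zero x
    | coe y => exact dist_stereoInv_coe_coe x y

theorem injective_stereoInv : Function.Injective (stereoInv (n := n)) := by
  have hne (x : Eu n) : stereoInv (x : ExtEu n) ≠ 0 := fun h =>
    hyperplanePoint_ne_zero x ((EuclideanGeometry.inversion_eq_center one_ne_zero).1 h)
  intro p q h
  induction p using OnePoint.rec with
  | infty =>
    induction q using OnePoint.rec with
    | infty => rfl
    | coe y => exact absurd h.symm (hne y)
  | coe x =>
    induction q using OnePoint.rec with
    | infty => exact absurd h (hne x)
    | coe y =>
      rw [isometry_hyperplanePoint.injective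
        (EuclideanGeometry.inversion_injective 0 one_ne_zero h)]

theorem continuous_stereoInv : Continuous (stereoInv (n := n)) := by
  refine (OnePoint.continuous_iff _).2 ⟨?_, ?_⟩
  · have hnorm : Tendsto (fun x : Eu n => √(1 + ‖x‖ ^ 2)) (cocompact (Eu n)) atTop :=
      tendsto_atTop_mono (fun x => Real.le_sqrt_of_sq_le (by linarith))
        (tendsto_norm_cocompact_atTop (E := Eu n))
    rw [coclosedCompact_eq_cocompact, tendsto_iff_dist_tendsto_zero]
    exact hnorm.inv_tendsto_atTop.congr fun x =>
      ((dist_stereoInv_coe_zero x).trans (one_div _)).symm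
  · exact continuous_const.inversion continuous_const isometry_hyperplanePoint.continuous
      hyperplanePoint_ne_zero

theorem exists_ofReal_le_chordalDist {S T : Set (ExtEu n)} (hS : IsCompact S) (hT : IsCompact T)
    (hST : Disjoint S T) : ∃ κ > 0, ENNReal.ofReal κ ≤ chordalDist S T := by
  obtain ⟨κ, hκ, hlt⟩ := Metric.exists_pos_forall_lt_edist (hS.image continuous_stereoInv)
    (hT.image continuous_stereoInv).isClosed ((disjoint_image_iff injective_stereoInv).2 hST)
  refine ⟨κ, hκ, le_iInf₂ fun p hp => le_iInf₂ fun q hq => ?_⟩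
  rw [← dist_stereoInv, ← edist_dist, ENNReal.ofReal_coe_nnreal]
  exact (hlt _ (mem_image_of_mem _ hp) _ (mem_image_of_mem _ hq)).le

theorem exists_nhds_forall_not_subset_of_le_chordalDiam {δ : ℝ} (hδ : 0 < δ) (p : ExtEu n) :
    ∃ U ∈ 𝓝 p, ∀ S, ENNReal.ofReal δ ≤ chordalDiam S → ¬ S ⊆ U := by
  refine ⟨stereoInv ⁻¹' ball (stereoInv p) (δ / 4),
    continuous_stereoInv.continuousAt (ball_mem_nhds _ (by positivity)), fun S hS hsub => ?_⟩
  have hdiam : chordalDiam S ≤ ENNReal.ofReal (δ / 2) := by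
    refine iSup₂_le fun x hx => iSup₂_le fun y hy => ENNReal.ofReal_le_ofReal ?_
    rw [← dist_stereoInv]
    linarith [dist_triangle_right (stereoInv x) (stereoInv y) (stereoInv p),
      mem_ball.1 (hsub hx), mem_ball.1 (hsub hy)]
  exact (hS.trans hdiam).not_gt ((ENNReal.ofReal_lt_ofReal_iff hδ).2 (half_lt_self hδ))

end ChordalMetric

section BoundaryNeighbourhoods

variable {n : ℕ}

theorem isOpen_compl_toExt_closedBall (c : Eu n) (r : ℝ) : IsOpen (toExt (closedBall c r))ᶜ :=
  OnePoint.isOpen_compl_image_coe.2 ⟨isClosed_closedBall, isCompact_closedBall c r⟩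

theorem inter_toExt_sphere_nonempty {S : Set (ExtEu n)} (hS : IsPreconnected S) {c : Eu n} {r : ℝ}
    (hin : (S ∩ toExt (ball c r)).Nonempty) (hout : ¬ S ⊆ toExt (closedBall c r)) :
    (S ∩ toExt (sphere c r)).Nonempty := by
  rw [← not_disjoint_iff_nonempty_inter]
  intro hdisj
  have hcover : S ⊆ toExt (ball c r) ∪ (toExt (closedBall c r))ᶜ := by
    rintro p hp
    refine or_iff_not_imp_right.2 fun hpr => ?_
    obtain ⟨x, hx, rfl⟩ := not_not.1 hpr
    refine ⟨x, lt_of_le_of_ne hx fun h => hdisj.notMem_of_mem_left hp ⟨x, h, rfl⟩, rfl⟩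
  obtain ⟨p, -, hp, hp'⟩ := hS _ _ (OnePoint.isOpenEmbedding_coe.isOpenMap _ isOpen_ball)
    (isOpen_compl_toExt_closedBall c r) hcover hin (not_subset.1 hout)
  exact hp' (image_mono ball_subset_closedBall hp)

theorem exists_nhds_forall_inter_sphere_nonempty {p : ExtEu n} {U : Set (ExtEu n)} (hU : U ∈ 𝓝 p)
    {L : ℝ} (hL : 1 < L) :
    ∃ W ∈ 𝓝 p, ∃ (c : Eu n) (a : ℝ), 0 < a ∧ ∀ S, IsPreconnected S → (S ∩ W).Nonempty → ¬ S ⊆ U →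
      ∀ r ∈ Ioo a (L * a), (S ∩ toExt (sphere c r)).Nonempty := by
  have hL0 : 0 < L := one_pos.trans hL
  induction p using OnePoint.rec with
  | infty =>
    obtain ⟨R, hR⟩ : ∃ R, (closedBall (0 : Eu n) R)ᶜ ⊆ (↑) ⁻¹' U := by
      rw [← mem_cocompact_iff_closedBall_compl_subset, ← coclosedCompact_eq_cocompact]
      exact OnePoint.tendsto_coe_infty hU
    set a := max R 1
    refine ⟨(toExt (closedBall 0 (L * a)))ᶜ, (isOpen_compl_toExt_closedBall _ _).mem_nhds
      OnePoint.infty_notMem_image_coe, 0, a, by positivity, fun S hS hSW hSU r hr => ?_⟩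
    obtain ⟨w, hwS, hwW⟩ := hSW
    obtain ⟨q, hqS, hqU⟩ := not_subset.1 hSU
    have hq : q ≠ OnePoint.infty := fun h => hqU (h ▸ mem_of_mem_nhds hU)
    obtain ⟨x, rfl⟩ := OnePoint.ne_infty_iff_exists.1 hq
    have hx : x ∈ closedBall 0 R := by_contra fun h => hqU (hR h)
    exact inter_toExt_sphere_nonempty hS
      ⟨x, hqS, x, closedBall_subset_ball ((le_max_left _ _).trans_lt hr.1) hx, rfl⟩
      fun h => hwW (image_mono (closedBall_subset_closedBall hr.2.le) (h hwS))
  | coe x =>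
    obtain ⟨b, hb, hball⟩ := Metric.mem_nhds_iff.1 (OnePoint.continuous_coe.continuousAt hU)
    refine ⟨toExt (ball x (b / L)), OnePoint.isOpenEmbedding_coe.image_mem_nhds.2
      (ball_mem_nhds x (by positivity)), x, b / L, by positivity, fun S hS hSW hSU r hr => ?_⟩
    rw [mul_div_cancel₀ _ hL0.ne'] at hr
    refine inter_toExt_sphere_nonempty hS (hSW.mono ?_) fun h => hSU (h.trans ?_)
    · exact inter_subset_inter_right _ (image_mono (ball_subset_ball hr.1.le))
    · exact image_subset_iff.2 ((closedBall_subset_ball hr.2).trans hball)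

theorem exists_nhds_forall_disjoint_toExt (hn : 2 ≤ n) {δ : ℝ} (hδ : 0 < δ) {M : ℝ≥0∞} (hM : M ≠ ∞)
    {S : Set (ExtEu n)} (hS : IsPreconnected S) (hSn : S.Nontrivial) {p : ExtEu n} (hp : p ∈ S) :
    ∃ W ∈ 𝓝 p, ∀ {C : Set (Eu n)} {ρ : Eu n → ℝ≥0∞}, IsPreconnected C →
      ENNReal.ofReal δ ≤ chordalDiam (toExt C) → LipschitzAdmissible ρ C ((↑) ⁻¹' S) →
      ∫⁻ x, ρ x ^ n ≤ M → Disjoint (toExt C) W := by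
  obtain ⟨L, hL, hlt⟩ := exists_ratio_lt_lintegral_pow (V := Eu n) volume
    (by rwa [finrank_euclideanSpace_fin]) hM
  obtain ⟨U, hU, hδU⟩ := exists_nhds_forall_not_subset_of_le_chordalDiam hδ p
  obtain ⟨q, hq, hqp⟩ := hSn.exists_ne p
  obtain ⟨W, hW, c, a, ha, hmeet⟩ := exists_nhds_forall_inter_sphere_nonempty
    (inter_mem hU (isOpen_compl_singleton.mem_nhds hqp.symm)) hL
  refine ⟨W, hW, fun {C ρ} hC hCδ hρ hle => ?_⟩
  by_contra hCW
  refine hle.not_gt ?_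
  have h := hlt hρ ha (x₀ := c) fun r hr => ?_
  · rwa [finrank_euclideanSpace_fin] at h
  constructor
  · obtain ⟨_, ⟨x, hx, rfl⟩, y, hy, hyx⟩ := hmeet (toExt C)
      (hC.image _ OnePoint.continuous_coe.continuousOn) (not_disjoint_iff_nonempty_inter.1 hCW)
      (fun h => hδU _ hCδ (h.trans inter_subset_left)) r hr
    exact ⟨x, OnePoint.coe_injective hyx ▸ hy, hx⟩
  · obtain ⟨_, hyS, y, hy, rfl⟩ := hmeet S hS ⟨p, hp, mem_of_mem_nhds hW⟩
      (fun h => (h hq).2 rfl) r hr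
    exact ⟨y, hy, hyS⟩

theorem disjoint_toExt_extBoundary {D : Set (Eu n)} (hD : IsOpen D) :
    Disjoint (toExt D) (extBoundary D) :=
  disjoint_iff_inter_eq_empty.2 (OnePoint.isOpenEmbedding_coe.isOpenMap D hD).inter_frontier_eq

end BoundaryNeighbourhoods

theorem notMem_closure_iUnion {X ι : Type*} [TopologicalSpace X] {s : ι → Set X} {p : X}
    (hs : ∀ i, IsClosed (s i)) (hp : ∀ i, p ∉ s i) {W : Set X} (hW : W ∈ 𝓝 p)
    (hdisj : ∀ᶠ i in cofinite, Disjoint (s i) W) : p ∉ closure (⋃ i, s i) := by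
  have hnhds : W ∩ ⋂ i ∈ {i | ¬ Disjoint (s i) W}, (s i)ᶜ ∈ 𝓝 p :=
    inter_mem hW ((biInter_mem hdisj).2 fun i _ => (hs i).isOpen_compl.mem_nhds (hp i))
  intro h
  obtain ⟨x, hx, hxs⟩ := mem_closure_iff_nhds.1 h _ hnhds
  obtain ⟨i, hi⟩ := mem_iUnion.1 hxs
  exact mem_iInter₂.1 hx.2 i (not_disjoint_iff.2 ⟨x, hi, hx.1⟩) hi

end Approaching

end

open Approaching in
theorem lemma5p1_general {n : ℕ} (hn : 2 ≤ n) {ι : Type*} {δ : ℝ} (hδ : 0 < δ) {D D₀ E : Set (Eu n)}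
    (hD : IsOpen D) (hD₀ : IsOpen D₀) (hE : IsCompact E) (hED₀ : E ⊆ D₀) {Q : Eu n → ℝ≥0∞}
    (hQ : AEMeasurable Q) (hQint : IntegrableOverSpheres D₀ Q) (hbd : NondegenerateBoundary D)
    {f : ι → Eu n → Eu n} (hf : ∀ m, f m ∈ classR E Q δ D D₀)
    (hcov : ∀ K ⊆ D₀, IsCompact K → ∀ᶠ m in cofinite, K ⊆ f m '' D) :
    ∃ δ' > 0, ∀ m, f m ∈ classF E Q δ' D D₀ := by
  have : NeZero n := ⟨by lia⟩
  set C : ι → Set (ExtEu n) := fun m => toExt (D ∩ f m ⁻¹' E)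
  have hCcompact (m : ι) : IsCompact (C m) := (hf m).2.1.1.image OnePoint.continuous_coe
  have hCD (m : ι) : C m ⊆ toExt D := image_mono inter_subset_left
  obtain ⟨M, hM, hρ⟩ := exists_eventually_lipschitzAdmissible hQ hQint hD hD₀ hE hED₀
    (fun m => (hf m).1.openDiscreteClosed)
    (fun m y₀ hy₀ => (hf m).1.inversePoletsky y₀ (subset_closure hy₀)) hcov
  have hdisj : Disjoint (closure (⋃ m, C m)) (extBoundary D) := by
    refine disjoint_right.2 fun p hp => ?_
    set S := connectedComponentIn (extBoundary D) p
    have hSD : (↑) ⁻¹' S ⊆ Dᶜ := fun x hx hxD => (disjoint_toExt_extBoundary hD).notMem_of_mem_left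
      ⟨x, hxD, rfl⟩ (connectedComponentIn_subset _ _ hx)
    obtain ⟨W, hW, hWdisj⟩ := exists_nhds_forall_disjoint_toExt hn hδ hM
      isPreconnected_connectedComponentIn (hbd p hp) (mem_connectedComponentIn hp)
    refine notMem_closure_iUnion (fun m => (hCcompact m).isClosed)
      (fun m h => (disjoint_toExt_extBoundary hD).notMem_of_mem_right hp (hCD m h)) hW ?_
    filter_upwards [hρ] with m ⟨ρ, hadm, hle⟩
    exact hWdisj (hf m).2.1.2.isPreconnected (hf m).2.2 (hadm.mono subset_rfl hSD) hle
  obtain ⟨δ', hδ', hle⟩ := exists_ofReal_le_chordalDist isClosed_closure.isCompact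
    isClosed_frontier.isCompact hdisj
  exact ⟨δ', hδ', fun m => ⟨(hf m).1, (hf m).2.1, hle.trans <| biInf_mono fun _ h =>
    subset_closure (mem_iUnion_of_mem m h)⟩⟩

theorem lemma5p1 {n : ℕ} (hn : 2 ≤ n) (δ : ℝ) (hδ : 0 < δ)
    (D D₀ : Set (Approaching.Eu n))
    (hD : Approaching.IsRegion D) (hD₀ : Approaching.IsRegion D₀)
    (E : Set (Approaching.Eu n)) (hE : IsCompact E) (hED₀ : E ⊆ D₀)
    (Q : Approaching.Eu n → ENNReal) (hQ : AEMeasurable Q MeasureTheory.volume)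
    (hQ0 : ∀ y, y ∉ D₀ → Q y = 0)
    (hQint : Approaching.IntegrableOverSpheres D₀ Q)
    (hbd : Approaching.NondegenerateBoundary D)
    (f : ℕ → Approaching.Eu n → Approaching.Eu n)
    (hf : ∀ m, f m ∈ Approaching.classR E Q δ D D₀)
    (hker : Approaching.ConvergesToKernel (fun m => f m '' D) D₀) :
    ∃ δ' : ℝ, 0 < δ' ∧ ∀ m,
      ENNReal.ofReal δ' ≤
        Approaching.chordalDist (Approaching.toExt (D ∩ f m ⁻¹' E)) (Approaching.extBoundary D) ∧
      f m ∈ Approaching.classF E Q δ' D D₀ := by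
  obtain ⟨A₀, -, hkernel⟩ := hker
  obtain ⟨δ', hδ', h⟩ := lemma5p1_general hn hδ hD.1 hD₀.1 hE hED₀ hQ hQint hbd hf fun K hK hKc =>
    Nat.cofinite_eq_atTop ▸ eventually_atTop.2 ((hkernel id strictMono_id).1.2.2 K hK hKc)
  exact ⟨δ', hδ', fun m => ⟨(h m).2.2, h m⟩⟩
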